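/- Let $N\ge 1$ and let $J:\mathbb{R}^N\to[0,\infty)$ be a measurable, radially symmetric kernel that is positive near the origin (i.e. $J(z)>0$ for $0<|z|<\delta$, some $\delta>0$) and satisfies the Lévy condition $\int_{\mathbb{R}^N}J(z)\,(|z|^2\wedge 1)\,dz<\infty$. Assume that there are $0<\alpha\le 2$, $c>0$ and $R$ such that $J(z)\ge c|z|^{-N-\alpha}$ for all $|z|\ge R$. Let $\mathcal{L}f(x)=\mathrm{P.V.}\int_{\mathbb{R}^N}(f(x)-f(y))J(x-y)\,dy$, with Dirichlet form $\mathcal{E}(f,g)=\frac12\iint (f(x)-f(y))(g(x)-g(y))J(x-y)\,dx\,dy$ and multiplier $m(\xi)=\int_{\mathbb{R}^N}(1-\cos(z\cdot\xi))J(z)\,dz$. Let $u_0\in L^1(\mathbb{R}^N)\cap L^\infty(\mathbb{R}^N)$ be real-valued, and consider the problem $$\partial_t u+\mathcal{L}u=0\ \text{ in }\mathbb{R}^N\times(0,\infty),\qquad u(\cdot,0)=u_0 .$$ Then the solution $u$ satisfies $$\lim_{t\to\infty}\|u(t)\|_\infty=0 .$$ Precisely: (1) There are probability measures $\mu_t$,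 $t>0$, with Fourier transform $\widehat{\mu_t}(\xi)=e^{-m(\xi)t}$, and the solution $u(t)=u_0*\mu_t$ satisfies $\lim_{t\to\infty}\|u_0*\mu_t\|_\infty=0$. (2) Every weak solution $u$ satisfies $\|u(t)\|_\infty\to 0$ as $t\to\infty$, $t$ outside a null set of times (a weak solution is determined only up to null sets in $(x,t)$). Here a weak solution is a function $u$ with $u\in L^1(\mathbb{R}^N\times(0,T))$ and $\int_0^T\big(\|u(t)\|_2^2+\mathcal{E}(u(t),u(t))\big)\,dt<\infty$ for every $T>0$, such that $$\int_0^\infty\!\!\int_{\mathbb{R}^N}u\,\partial_t\varphi\,dx\,dt+\int_{\mathbb{R}^N}\varphi(x,0)u_0(x)\,dx=\int_0^\infty\mathcal{E}(u(t),\varphi(t))\,dt$$ for every $\varphi\in C^1(\mathbb{R}^N\times[0,\infty))$ vanishing for $|x|$ large and for $t$ large. -/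

import Mathlib

open MeasureTheory Filter Topology Set
open scoped ENNReal

namespace NonlocalHeat

/-- The Euclidean space of dimension `N`, with Lebesgue measure as `volume`. -/
abbrev Eucl (N : ℕ) : Type := EuclideanSpace ℝ (Fin N)

/-- A Lévy kernel: nonnegative, radially symmetric, positive near the origin, and such that
`∫ J(z) (|z|² ∧ 1) dz < ∞`. The value `J 0` plays no role; the kernel may be singular at `0`. -/
structure IsLevyKernel {N : ℕ} (J : Eucl N → ℝ) : Prop where
  measurable : Measurable J
  nonneg : ∀ z, 0 ≤ J z
  radial : ∀ z w, ‖z‖ = ‖w‖ → J z = J w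
  pos_near_zero : ∃ δ > 0, ∀ z, 0 < ‖z‖ → ‖z‖ < δ → 0 < J z
  integrable : Integrable (fun z => J z * min (‖z‖ ^ 2) 1) volume

/-- The quadratic Dirichlet form
`𝓔(f, f) = (1/2) ∬ (f(x) - f(y))² J(x - y) dx dy`, with values in `[0, ∞]`. -/
noncomputable def energy {N : ℕ} (J : Eucl N → ℝ) (f : Eucl N → ℝ) : ℝ≥0∞ :=
  2⁻¹ * ∫⁻ p : Eucl N × Eucl N, ENNReal.ofReal ((f p.1 - f p.2) ^ 2 * J (p.1 - p.2))

/-- The bilinear Dirichlet form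
`𝓔(f, g) = (1/2) ∬ (f(x) - f(y)) (g(x) - g(y)) J(x - y) dx dy`. The integral converges absolutely
when `energy J f` and `energy J g` are finite. -/
noncomputable def dirichletForm {N : ℕ} (J : Eucl N → ℝ) (f g : Eucl N → ℝ) : ℝ :=
  2⁻¹ * ∫ p : Eucl N × Eucl N, (f p.1 - f p.2) * (g p.1 - g p.2) * J (p.1 - p.2)

/-- Test functions: the functions of class `C¹` in time and space, up to `t = 0` (written as
restrictions of `C¹` functions on `ℝ × ℝᴺ`), vanishing for `|x|` large and for `t` large. -/
structure IsTestFunction {N : ℕ} (φ : ℝ × Eucl N → ℝ) : Prop where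
  contDiff : ContDiff ℝ 1 φ
  vanish : ∃ R : ℝ, ∀ t x, R ≤ t ∨ R ≤ ‖x‖ → φ (t, x) = 0

/-- Weak solutions `u = u(t, x)` of `∂ₜu + 𝓛u = 0`, `u(0) = u₀`: for every `T > 0` the function `u`
lies in `L¹((0,T) × ℝᴺ)` and in `L²((0,T); 𝓗)`, where `‖f‖²_𝓗 = ‖f‖₂² + 𝓔(f, f)`, and the
equation holds against every test function. -/
structure IsWeakSolution {N : ℕ} (J : Eucl N → ℝ) (u₀ : Eucl N → ℝ) (u : ℝ → Eucl N → ℝ) :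
    Prop where
  integrable : ∀ T > 0, Integrable (fun p : ℝ × Eucl N => u p.1 p.2)
    ((volume.restrict (Ioo 0 T)).prod volume)
  memL2H : ∀ T > 0, ∫⁻ t in Ioo 0 T, (eLpNorm (u t) 2 volume ^ 2 + energy J (u t)) < ∞
  weak_eq : ∀ φ : ℝ × Eucl N → ℝ, IsTestFunction φ →
    (∫ t in Ioi (0 : ℝ), ∫ x, u t x * deriv (fun s => φ (s, x)) t) + (∫ x, φ (0, x) * u₀ x)
      = ∫ t in Ioi (0 : ℝ), dirichletForm J (u t) (fun x => φ (t, x))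

/-- The multiplier (symbol) `m(ξ) = ∫ (1 - cos (z · ξ)) J(z) dz` of the operator `𝓛`. -/
noncomputable def multiplier {N : ℕ} (J : Eucl N → ℝ) (ξ : Eucl N) : ℝ :=
  ∫ z, (1 - Real.cos (inner ℝ z ξ)) * J z

/-- `μ` is the fundamental solution: for every `t > 0`, `μ t` is the probability measure with
Fourier transform `exp (- t m(ξ))`. These conditions determine `μ t` for `t > 0`. -/
def IsFundamentalSolution {N : ℕ} (J : Eucl N → ℝ) (μ : ℝ → Measure (Eucl N)) : Prop :=
  ∀ t > 0, IsProbabilityMeasure (μ t) ∧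
    ∀ ξ, charFun (μ t) ξ = (Real.exp (-(t * multiplier J ξ)) : ℂ)

/-- The convolution `(f * ν)(x) = ∫ f(x - y) dν(y)` of a function with a measure. -/
noncomputable def convMeasure {N : ℕ} (f : Eucl N → ℝ) (ν : Measure (Eucl N)) (x : Eucl N) : ℝ :=
  ∫ y, f (x - y) ∂ν

end NonlocalHeat

namespace NonlocalHeat

/-! ### Compound Poisson laws and their density bounds. -/

section CompoundPoisson

/-! Decay. Let `S` be a symmetric set of finite positive measure on which `J ≥ a > 0`, and split the
jump density `t J` as `(t J - K) + K` with `K = t a 1_S`. Exponents add, so `μ t` is the convolution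
of a probability measure `ν` with the compound Poisson law of `K`. That law has an atom of mass `exp
(-t a |S|)` at the origin (no jump), and its remainder has density at most `1 / |S|`: `K` is bounded
by `t a`, its total mass is `t a |S|`, and `t a` cancels (`compoundPoisson_le`). Convolution with
`ν` does not spoil this, hence `‖u₀ * μ t‖_∞ ≤ exp (-t a |S|) ‖u₀‖_∞ + |S|⁻¹ ‖u₀‖₁`
(`eLpNorm_convMeasure_le`). The tail bound keeps `J` away from zero on shells of arbitrarily large
volume: choose the shell first, then let `t → ∞`.

Existence of `μ t`. Cutting `J` off near the origin gives finite jump measures, hence compound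
Poisson laws; their characteristic functions converge to a function continuous at `0`, and tightness
supplies a limit law.

Uniqueness of weak solutions. Against a `C^{1,1}` function the Dirichlet form becomes `∫ u 𝓛ψ`,
where `𝓛` is written with second differences and so converges absolutely. The functions `cos (x · ξ
+ b)` are eigenfunctions of `𝓛` with eigenvalue `m(ξ)`; they are reached as limits of cut-off test
functions. Each cosine coefficient of `u(t)` then solves `a' = -m(ξ) a` weakly, so it equals `exp
(-t m(ξ))` times its initial value for almost every `t`. Injectivity of the Fourier transform on
`L¹` gives `u(t) = u₀ * μ t` for almost every `t`, and the decay applies. -/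

theorem tsum_poisson_weights {E : Type*} [MeasurableSpace E] (κ : Measure E) [IsFiniteMeasure κ] :
    ∑' n : ℕ, ENNReal.ofReal (Real.exp (-κ.real univ) / (n.factorial : ℝ)) * κ univ ^ n = 1 := by
  have h : ∀ n : ℕ, ENNReal.ofReal (Real.exp (-κ.real univ) / (n.factorial : ℝ)) * κ univ ^ n
      = ENNReal.ofReal (Real.exp (-κ.real univ) * (κ.real univ ^ n / (n.factorial : ℝ))) := by
    intro n
    rw [← ofReal_measureReal (μ := κ) (s := univ), ← ENNReal.ofReal_pow measureReal_nonneg,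
      ← ENNReal.ofReal_mul (by positivity)]
    congr 1; ring
  have hs := (NormedSpace.expSeries_div_hasSum_exp (𝔸 := ℝ) (κ.real univ)).mul_left
    (Real.exp (-κ.real univ))
  rw [← Real.exp_eq_exp_ℝ, ← Real.exp_add, neg_add_cancel, Real.exp_zero] at hs
  simp_rw [h]
  rw [← ENNReal.ofReal_tsum_of_nonneg (fun n => by positivity) hs.summable, hs.tsum_eq,
    ENNReal.ofReal_one]

variable {E : Type*} [NormedAddCommGroup E] [InnerProductSpace ℝ E] [FiniteDimensional ℝ E]
  [MeasurableSpace E] [BorelSpace E]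

/-- The `n`-fold convolution power of a measure. -/
noncomputable def convPow (κ : Measure E) : ℕ → Measure E
  | 0 => Measure.dirac 0
  | n + 1 => (convPow κ n).conv κ

instance convPow_isFiniteMeasure (κ : Measure E) [IsFiniteMeasure κ] (n : ℕ) :
    IsFiniteMeasure (convPow κ n) := by
  induction n with
  | zero => simp only [convPow]; infer_instance
  | succ n ih => simp only [convPow]; infer_instance

theorem convPow_univ (κ : Measure E) [IsFiniteMeasure κ] (n : ℕ) :
    convPow κ n univ = κ univ ^ n := by
  induction n with
  | zero => simp [convPow]
  | succ n ih =>
    rw [convPow, Measure.conv, Measure.map_apply (by fun_prop) MeasurableSet.univ, preimage_univ,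
      Measure.prod_apply MeasurableSet.univ]
    simp [ih, pow_succ, mul_comm]

theorem charFun_convPow (κ : Measure E) [IsFiniteMeasure κ] (n : ℕ) (ξ : E) :
    charFun (convPow κ n) ξ = charFun κ ξ ^ n := by
  induction n with
  | zero => simp [convPow]
  | succ n ih => rw [convPow, charFun_conv, ih, pow_succ]

/-- The compound Poisson distribution with jump measure `κ`. -/
noncomputable def compoundPoisson (κ : Measure E) : Measure E :=
  Measure.sum fun n : ℕ =>
    ENNReal.ofReal (Real.exp (-κ.real univ) / (n.factorial : ℝ)) • convPow κ n

instance compoundPoisson_isProbabilityMeasure (κ : Measure E) [IsFiniteMeasure κ] :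
    IsProbabilityMeasure (compoundPoisson κ) := by
  constructor
  rw [compoundPoisson, Measure.sum_apply _ MeasurableSet.univ]
  simpa [convPow_univ] using tsum_poisson_weights κ

theorem charFun_compoundPoisson (κ : Measure E) [IsFiniteMeasure κ] (ξ : E) :
    charFun (compoundPoisson κ) ξ = Complex.exp (charFun κ ξ - κ.real univ) := by
  have hint : Integrable (fun x : E => Complex.exp ((inner ℝ x ξ : ℝ) * Complex.I))
      (compoundPoisson κ) :=
    (integrable_const (1 : ℝ)).mono (by fun_prop) (by simp [Complex.norm_exp_ofReal_mul_I])
  have h1 := hasSum_integral_measure (μ := fun n : ℕ =>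
    ENNReal.ofReal (Real.exp (-κ.real univ) / (n.factorial : ℝ)) • convPow κ n) hint
  have h2 : ∀ n : ℕ, ∫ x, Complex.exp ((inner ℝ x ξ : ℝ) * Complex.I)
      ∂(ENNReal.ofReal (Real.exp (-κ.real univ) / (n.factorial : ℝ)) • convPow κ n)
      = Complex.exp (-κ.real univ) * (charFun κ ξ ^ n / (n.factorial : ℂ)) := by
    intro n
    rw [integral_smul_measure, ← charFun_apply, charFun_convPow,
      ENNReal.toReal_ofReal (by positivity), Complex.real_smul]
    push_cast
    ring
  simp_rw [h2] at h1
  have hs := (NormedSpace.expSeries_div_hasSum_exp (𝔸 := ℂ) (charFun κ ξ)).mul_left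
    (Complex.exp (-κ.real univ))
  rw [← Complex.exp_eq_exp_ℂ, ← Complex.exp_add] at hs
  rw [charFun_apply]
  refine (h1.unique hs).trans ?_
  congr 1; ring

/-- One factor of the convolution carries the density bound `C`; the other `n` factors only average
its translates, by translation invariance of `V`, and contribute their mass. -/
theorem convPow_succ_le (κ V : Measure E) [IsFiniteMeasure κ] [V.IsAddLeftInvariant]
    {C : ℝ≥0∞} (hκ : κ ≤ C • V) (n : ℕ) :
    convPow κ (n + 1) ≤ (C * κ univ ^ n) • V := by
  refine Measure.le_iff.2 fun A hA => ?_
  rw [convPow, ← lintegral_indicator_one hA,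
    Measure.lintegral_conv (measurable_one.indicator hA)]
  calc ∫⁻ x, ∫⁻ y, A.indicator 1 (x + y) ∂κ ∂(convPow κ n)
      ≤ ∫⁻ _, C * V A ∂(convPow κ n) := by
        refine lintegral_mono fun x => ?_
        have hm : MeasurableSet ((fun y => x + y) ⁻¹' A) := (measurable_const_add x) hA
        have : (fun y => A.indicator (1 : E → ℝ≥0∞) (x + y))
            = ((fun y => x + y) ⁻¹' A).indicator 1 := rfl
        rw [this, lintegral_indicator_one hm]
        refine (hκ _).trans ?_
        simp [measure_preimage_add]
    _ = ((C * κ univ ^ n) • V) A := by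
        simp [convPow_univ]; ring

/-- The term `n = 0` is the atom. The others have density at most `C` times the sum of `a (n + 1) *
κ univ ^ n`, and multiplying that sum by `κ univ` gives part of the Poisson weights, whose total is
`1`. -/
theorem compoundPoisson_le (κ V : Measure E) [IsFiniteMeasure κ] [V.IsAddLeftInvariant]
    {C : ℝ≥0∞} (hκ : κ ≤ C • V) (hpos : κ univ ≠ 0) :
    compoundPoisson κ ≤
      ENNReal.ofReal (Real.exp (-κ.real univ)) • Measure.dirac 0 + (C / κ univ) • V := by
  set a : ℕ → ℝ≥0∞ := fun n => ENNReal.ofReal (Real.exp (-κ.real univ) / (n.factorial : ℝ)) with ha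
  have htop : κ univ ≠ ∞ := measure_ne_top _ _
  have hsum : ∑' n, a (n + 1) * κ univ ^ n ≤ (κ univ)⁻¹ := by
    rw [← one_div, ENNReal.le_div_iff_mul_le (.inl hpos) (.inl htop), ← ENNReal.tsum_mul_right]
    calc ∑' n, a (n + 1) * κ univ ^ n * κ univ
        ≤ a 0 * κ univ ^ 0 + ∑' n, a (n + 1) * κ univ ^ (n + 1) := by
          simp_rw [pow_succ, mul_assoc]; exact le_add_self
      _ = 1 := by
          rw [← tsum_poisson_weights κ]
          exact (tsum_eq_zero_add' (f := fun n => a n * κ univ ^ n) ENNReal.summable).symm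
  refine Measure.le_iff.2 fun A hA => ?_
  rw [compoundPoisson, Measure.sum_apply _ hA, tsum_eq_zero_add' ENNReal.summable,
    Measure.add_apply]
  refine add_le_add (by simp [convPow]) ?_
  calc ∑' n, (a (n + 1) • convPow κ (n + 1)) A
      ≤ ∑' n, (a (n + 1) * κ univ ^ n) * (C * V A) := by
        refine ENNReal.tsum_le_tsum fun n => ?_
        have := convPow_succ_le κ V hκ n A
        simp only [Measure.smul_apply, smul_eq_mul] at this ⊢
        calc a (n + 1) * convPow κ (n + 1) A ≤ a (n + 1) * (C * κ univ ^ n * V A) := by gcongr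
          _ = _ := by ring
    _ ≤ (κ univ)⁻¹ * (C * V A) := by rw [ENNReal.tsum_mul_right]; gcongr
    _ = ((C / κ univ) • V) A := by
        simp [div_eq_mul_inv]; ring

end CompoundPoisson

/-! ### Limits of characteristic functions. -/

/-- A pointwise limit of characteristic functions of probability measures that is continuous at the
origin is the characteristic function of a probability measure. -/
theorem exists_charFun_eq_of_tendsto {E : Type*} [NormedAddCommGroup E] [InnerProductSpace ℝ E]
    [FiniteDimensional ℝ E] [MeasurableSpace E] [BorelSpace E] {μ : ℕ → Measure E}
    [hμ : ∀ n, IsProbabilityMeasure (μ n)] {f : E → ℂ} (hf : ContinuousAt f 0)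
    (h : ∀ ξ, Tendsto (fun n => charFun (μ n) ξ) atTop (𝓝 (f ξ))) :
    ∃ ν : Measure E, IsProbabilityMeasure ν ∧ ∀ ξ, charFun ν ξ = f ξ := by
  have htight := isTightMeasureSet_of_tendsto_charFun hf h
  let P : ℕ → ProbabilityMeasure E := fun n => ⟨μ n, hμ n⟩
  have hcomp : IsCompact (closure (range P)) := by
    refine isCompact_closure_of_isTightMeasureSet ?_
    convert htight using 1
    ext ν
    constructor
    · rintro ⟨_, ⟨n, rfl⟩, rfl⟩; exact ⟨n, rfl⟩
    · rintro ⟨n, rfl⟩; exact ⟨_, ⟨n, rfl⟩, rfl⟩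
  -- An ultrafilter finer than `atTop` picks a weak limit point of the tight family without
  -- extracting a subsequence; convergence of the characteristic functions then identifies it.
  let U : Ultrafilter ℕ := Ultrafilter.of atTop
  have hU : (U : Filter ℕ) ≤ atTop := Ultrafilter.of_le atTop
  obtain ⟨ν, -, hν⟩ := hcomp.ultrafilter_le_nhds (U.map P)
    (by
      rw [le_principal_iff]
      exact mem_of_superset (Filter.univ_mem' (f := (U : Filter ℕ)) fun n =>
        subset_closure (mem_range_self n)) (by exact fun _ h => h))
  refine ⟨ν, ν.2, fun ξ => ?_⟩
  have hν' : Tendsto P (U : Filter ℕ) (𝓝 ν) := hν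
  rw [ProbabilityMeasure.tendsto_iff_forall_integral_rclike_tendsto ℂ] at hν'
  have h1 := hν' (BoundedContinuousFunction.innerProbChar ξ)
  simp_rw [← charFun_eq_integral_innerProbChar] at h1
  exact tendsto_nhds_unique h1 ((h ξ).mono_left hU)

/-! ### Even Lévy densities and their multipliers. -/

variable {N : ℕ}

/-- An even Lévy density: like `IsLevyKernel`, but only even, and possibly vanishing. -/
structure IsEvenLevyDensity (J : Eucl N → ℝ) : Prop where
  measurable : Measurable J
  nonneg : ∀ z, 0 ≤ J z
  even : ∀ z, J (-z) = J z
  integrable : Integrable (fun z => J z * min (‖z‖ ^ 2) 1) volume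

theorem IsLevyKernel.isEvenLevyDensity {J : Eucl N → ℝ} (hJ : IsLevyKernel J) :
    IsEvenLevyDensity J :=
  ⟨hJ.measurable, hJ.nonneg, fun z => hJ.radial _ _ (norm_neg z), hJ.integrable⟩

namespace IsEvenLevyDensity

variable {J K : Eucl N → ℝ}

/-- Applied to densities supported on a set `S`, which may vanish near the origin; this is why the
class does not ask for positivity there. -/
theorem mono (hJ : IsEvenLevyDensity J) (hm : Measurable K) (h0 : ∀ z, 0 ≤ K z)
    (heven : ∀ z, K (-z) = K z) (hle : ∀ z, K z ≤ J z) : IsEvenLevyDensity K := by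
  refine ⟨hm, h0, heven, hJ.integrable.mono' (by fun_prop) (ae_of_all _ fun z => ?_)⟩
  have : 0 ≤ min (‖z‖ ^ 2) 1 := by positivity
  rw [Real.norm_of_nonneg (mul_nonneg (h0 z) this)]
  exact mul_le_mul_of_nonneg_right (hle z) this

theorem const_mul (hJ : IsEvenLevyDensity J) {t : ℝ} (ht : 0 ≤ t) :
    IsEvenLevyDensity fun z => t * J z := by
  refine ⟨hJ.measurable.const_mul t, fun z => mul_nonneg ht (hJ.nonneg z),
    fun z => by rw [hJ.even], ?_⟩
  simpa only [mul_assoc] using hJ.integrable.const_mul t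

theorem sub (hJ : IsEvenLevyDensity J) (hK : IsEvenLevyDensity K) (hle : ∀ z, K z ≤ J z) :
    IsEvenLevyDensity fun z => J z - K z :=
  hJ.mono (hJ.measurable.sub hK.measurable) (fun z => sub_nonneg.2 (hle z))
    (fun z => by rw [hJ.even, hK.even]) fun z => sub_le_self _ (hK.nonneg z)

end IsEvenLevyDensity

/-- `1 - cos` is at most `2` and at most quadratic in its argument, which matches the two regimes of
the Lévy weight. -/
theorem one_sub_cos_inner_le (z ξ : Eucl N) :
    1 - Real.cos (inner ℝ z ξ) ≤ (2 + ‖ξ‖ ^ 2) * min (‖z‖ ^ 2) 1 := by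
  have h1 : 1 - Real.cos (inner ℝ z ξ) ≤ 2 := by linarith [Real.neg_one_le_cos (inner ℝ z ξ)]
  have h2 : 1 - Real.cos (inner ℝ z ξ) ≤ ‖ξ‖ ^ 2 * ‖z‖ ^ 2 := by
    have h3 := Real.one_sub_sq_div_two_le_cos (x := inner ℝ z ξ)
    have h4 : (inner ℝ z ξ) ^ 2 ≤ (‖z‖ * ‖ξ‖) ^ 2 := by
      rw [← sq_abs (inner ℝ z ξ)]
      gcongr
      exact abs_real_inner_le_norm z ξ
    nlinarith [sq_nonneg (‖z‖ * ‖ξ‖)]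
  rcases min_cases (‖z‖ ^ 2) 1 with ⟨h, -⟩ | ⟨h, -⟩ <;> rw [h] <;>
    nlinarith [sq_nonneg ‖z‖, sq_nonneg ‖ξ‖]

theorem one_sub_cos_inner_nonneg (z ξ : Eucl N) : 0 ≤ 1 - Real.cos (inner ℝ z ξ) :=
  sub_nonneg.2 (Real.cos_le_one _)

section Multiplier

variable {J : Eucl N → ℝ}

theorem IsEvenLevyDensity.norm_multiplier_integrand_le (hJ : IsEvenLevyDensity J)
    (z ξ : Eucl N) :
    ‖(1 - Real.cos (inner ℝ z ξ)) * J z‖ ≤ (2 + ‖ξ‖ ^ 2) * (J z * min (‖z‖ ^ 2) 1) := by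
  rw [Real.norm_of_nonneg (mul_nonneg (one_sub_cos_inner_nonneg z ξ) (hJ.nonneg z))]
  nlinarith [mul_le_mul_of_nonneg_right (one_sub_cos_inner_le z ξ) (hJ.nonneg z)]

theorem IsEvenLevyDensity.integrable_multiplier (hJ : IsEvenLevyDensity J) (ξ : Eucl N) :
    Integrable (fun z => (1 - Real.cos (inner ℝ z ξ)) * J z) := by
  have := hJ.measurable
  exact (hJ.integrable.const_mul (2 + ‖ξ‖ ^ 2)).mono' (by fun_prop)
    (ae_of_all _ fun z => hJ.norm_multiplier_integrand_le z ξ)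

theorem IsEvenLevyDensity.continuousAt_multiplier_zero (hJ : IsEvenLevyDensity J) :
    ContinuousAt (multiplier J) 0 := by
  have := hJ.measurable
  unfold multiplier
  refine continuousAt_of_dominated (bound := fun z => 3 * (J z * min (‖z‖ ^ 2) 1))
    (Eventually.of_forall fun ξ => by fun_prop) ?_ (hJ.integrable.const_mul 3)
    (ae_of_all _ fun z => by fun_prop)
  filter_upwards [Metric.closedBall_mem_nhds (0 : Eucl N) one_pos] with ξ hξ
  rw [mem_closedBall_zero_iff] at hξ
  refine ae_of_all _ fun z => (hJ.norm_multiplier_integrand_le z ξ).trans ?_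
  have h0 : 0 ≤ J z * min (‖z‖ ^ 2) 1 := mul_nonneg (hJ.nonneg z) (by positivity)
  gcongr
  nlinarith [norm_nonneg ξ]

theorem multiplier_const_mul (J : Eucl N → ℝ) (t : ℝ) (ξ : Eucl N) :
    multiplier (fun z => t * J z) ξ = t * multiplier J ξ := by
  rw [multiplier, multiplier, ← integral_const_mul]
  exact integral_congr_ae (ae_of_all _ fun z => by ring)

theorem multiplier_sub {J K : Eucl N → ℝ} (hJ : IsEvenLevyDensity J) (hK : IsEvenLevyDensity K)
    (ξ : Eucl N) :
    multiplier (fun z => J z - K z) ξ = multiplier J ξ - multiplier K ξ := by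
  rw [multiplier, multiplier, multiplier,
    ← integral_sub (hJ.integrable_multiplier ξ) (hK.integrable_multiplier ξ)]
  exact integral_congr_ae (ae_of_all _ fun z => by ring)

end Multiplier

/-! ### Existence of the fundamental solution. -/

/-- The measure with density `K`. -/
noncomputable abbrev densityMeasure (K : Eucl N → ℝ) : Measure (Eucl N) :=
  volume.withDensity fun z => ENNReal.ofReal (K z)

theorem isFiniteMeasure_densityMeasure {K : Eucl N → ℝ} (hK : Integrable K) :
    IsFiniteMeasure (densityMeasure K) :=
  isFiniteMeasure_withDensity_ofReal hK.2

theorem densityMeasure_real_univ {K : Eucl N → ℝ} (h0 : ∀ z, 0 ≤ K z) (hK : Integrable K) :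
    (densityMeasure K).real univ = ∫ z, K z := by
  rw [measureReal_def, withDensity_apply _ MeasurableSet.univ, Measure.restrict_univ,
    ← ofReal_integral_eq_lintegral_ofReal hK (ae_of_all _ h0),
    ENNReal.toReal_ofReal (integral_nonneg h0)]

/-- Integrals of odd functions vanish. -/
theorem integral_eq_zero_of_odd {f : Eucl N → ℝ} (hf : ∀ z, f (-z) = -f z) : ∫ z, f z = 0 := by
  have h := integral_neg_eq_self f (volume : Measure (Eucl N))
  simp_rw [hf, integral_neg] at h
  linarith

theorem integrable_mul_bounded {K g : Eucl N → ℝ} (hK : Integrable K) (hg : Continuous g)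
    (hb : ∀ z, |g z| ≤ 1) : Integrable fun z => K z * g z :=
  hK.mul_bdd (c := 1) hg.aestronglyMeasurable (ae_of_all _ hb)

/-- Evenness of `K` kills the sine part, so the transform is real. -/
theorem charFun_densityMeasure {K : Eucl N → ℝ} (hm : Measurable K) (h0 : ∀ z, 0 ≤ K z)
    (heven : ∀ z, K (-z) = K z) (hK : Integrable K) (ξ : Eucl N) :
    charFun (densityMeasure K) ξ = ((∫ z, K z) - multiplier K ξ : ℝ) := by
  rw [charFun_apply, integral_withDensity_eq_integral_toReal_smul (by fun_prop)
    (ae_of_all _ fun z => ENNReal.ofReal_lt_top)]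
  have hcos : Integrable fun z => K z * Real.cos (inner ℝ z ξ) :=
    integrable_mul_bounded hK (by fun_prop) fun z => Real.abs_cos_le_one _
  have hsin : Integrable fun z => K z * Real.sin (inner ℝ z ξ) :=
    integrable_mul_bounded hK (by fun_prop) fun z => Real.abs_sin_le_one _
  have h1 : ∀ z : Eucl N, (ENNReal.ofReal (K z)).toReal •
      Complex.exp ((inner ℝ z ξ : ℝ) * Complex.I)
      = ((K z * Real.cos (inner ℝ z ξ) : ℝ) : ℂ)
        + ((K z * Real.sin (inner ℝ z ξ) : ℝ) : ℂ) * Complex.I := by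
    intro z
    rw [ENNReal.toReal_ofReal (h0 z), Complex.exp_mul_I, Complex.real_smul]
    push_cast
    ring
  simp_rw [h1]
  rw [integral_add hcos.ofReal (hsin.ofReal.mul_const _), integral_mul_const, integral_complex_ofReal,
    integral_complex_ofReal, integral_eq_zero_of_odd (f := fun z => K z * Real.sin (inner ℝ z ξ))
      fun z => by rw [heven, inner_neg_left, Real.sin_neg, mul_neg], multiplier]
  have h2 : ∫ z, (1 - Real.cos (inner ℝ z ξ)) * K z
      = (∫ z, K z) - ∫ z, K z * Real.cos (inner ℝ z ξ) := by
    rw [← integral_sub hK hcos]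
    exact integral_congr_ae (ae_of_all _ fun z => by ring)
  rw [h2]
  simp

theorem charFun_compoundPoisson_densityMeasure {K : Eucl N → ℝ} (hm : Measurable K)
    (h0 : ∀ z, 0 ≤ K z) (heven : ∀ z, K (-z) = K z) (hK : Integrable K) (ξ : Eucl N) :
    charFun (compoundPoisson (densityMeasure K)) ξ = (Real.exp (-multiplier K ξ) : ℂ) := by
  have := isFiniteMeasure_densityMeasure hK
  rw [charFun_compoundPoisson, charFun_densityMeasure hm h0 heven hK,
    densityMeasure_real_univ h0 hK, ← Complex.ofReal_sub, ← Complex.ofReal_exp]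
  simp

/-- Existence of the infinitely divisible law with even Lévy density `J`. -/
theorem IsEvenLevyDensity.exists_charFun_eq {J : Eucl N → ℝ} (hJ : IsEvenLevyDensity J) :
    ∃ μ : Measure (Eucl N), IsProbabilityMeasure μ ∧
      ∀ ξ, charFun μ ξ = (Real.exp (-multiplier J ξ) : ℂ) := by
  -- Removing a ball of radius `1 / (n + 1)` makes the density integrable, so the jump measure is
  -- finite.
  let S : ℕ → Set (Eucl N) := fun n => {z | 1 / ((n : ℝ) + 1) ≤ ‖z‖}
  have hS : ∀ n, MeasurableSet (S n) := fun n => measurableSet_le measurable_const measurable_norm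
  let K : ℕ → Eucl N → ℝ := fun n => (S n).indicator J
  have hKm : ∀ n, Measurable (K n) := fun n => hJ.measurable.indicator (hS n)
  have hK0 : ∀ n z, 0 ≤ K n z := fun n z => indicator_nonneg (fun z _ => hJ.nonneg z) z
  have hKle : ∀ n z, K n z ≤ J z := fun n z => indicator_le_self' (fun z _ => hJ.nonneg z) z
  have hKe : ∀ n z, K n (-z) = K n z := by
    intro n z
    simp only [K, indicator, S, mem_ofPred_eq, norm_neg, hJ.even]
  have hKi : ∀ n, Integrable (K n) := by
    intro n
    have hc : (0 : ℝ) < 1 / ((n : ℝ) + 1) := by positivity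
    refine (hJ.integrable.const_mul (((n : ℝ) + 1) ^ 2)).mono' (hKm n).aestronglyMeasurable
      (ae_of_all _ fun z => ?_)
    rw [Real.norm_of_nonneg (hK0 n z)]
    have hmin : 0 ≤ min (‖z‖ ^ 2) 1 := by positivity
    by_cases hz : z ∈ S n
    · have h1 : 1 ≤ ((n : ℝ) + 1) * ‖z‖ := by
        have : 1 / ((n : ℝ) + 1) ≤ ‖z‖ := hz
        rwa [div_le_iff₀' (by positivity)] at this
      have h2 : 1 ≤ ((n : ℝ) + 1) ^ 2 * min (‖z‖ ^ 2) 1 := by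
        rcases min_cases (‖z‖ ^ 2) 1 with ⟨h, -⟩ | ⟨h, -⟩ <;> rw [h]
        · rw [← mul_pow]; exact one_le_pow₀ h1
        · nlinarith [(Nat.cast_nonneg n : (0 : ℝ) ≤ n)]
      simp only [K, indicator_of_mem hz]
      nlinarith [hJ.nonneg z]
    · simp only [K, indicator_of_notMem hz]
      have := hJ.nonneg z
      positivity
  have hprob : ∀ n, IsProbabilityMeasure (compoundPoisson (densityMeasure (K n))) := fun n =>
    have := isFiniteMeasure_densityMeasure (hKi n)
    inferInstance
  refine exists_charFun_eq_of_tendsto (μ := fun n => compoundPoisson (densityMeasure (K n)))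
    (f := fun ξ => (Real.exp (-multiplier J ξ) : ℂ)) ?_ fun ξ => ?_
  · exact Complex.continuous_ofReal.continuousAt.comp
      (Real.continuous_exp.continuousAt.comp hJ.continuousAt_multiplier_zero.neg)
  · simp_rw [charFun_compoundPoisson_densityMeasure (hKm _) (hK0 _) (hKe _) (hKi _)]
    refine (Complex.continuous_ofReal.tendsto _).comp ((Real.continuous_exp.tendsto _).comp ?_)
    refine Tendsto.neg (tendsto_integral_of_dominated_convergence
      (fun z => (2 + ‖ξ‖ ^ 2) * (J z * min (‖z‖ ^ 2) 1))
      (fun n => by have := hKm n; fun_prop) (hJ.integrable.const_mul _) (fun n => ?_) ?_)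
    · refine ae_of_all _ fun z => le_trans ?_ (hJ.norm_multiplier_integrand_le z ξ)
      rw [norm_mul, norm_mul, Real.norm_of_nonneg (hK0 n z), Real.norm_of_nonneg (hJ.nonneg z)]
      exact mul_le_mul_of_nonneg_left (hKle n z) (norm_nonneg _)
    · refine ae_of_all _ fun z => ?_
      -- The origin lies in no `S n`, but there `1 - cos` vanishes; every other point lies in `S n`
      -- from some `n` on.
      rcases eq_or_ne z 0 with rfl | hz
      · simp
      · refine Tendsto.const_mul _ (tendsto_const_nhds.congr' ?_)
        obtain ⟨n₀, hn₀⟩ := exists_nat_one_div_lt (norm_pos_iff.2 hz)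
        filter_upwards [eventually_ge_atTop n₀] with n hn
        have : z ∈ S n := (Nat.one_div_le_one_div hn).trans hn₀.le
        simp only [K, indicator_of_mem this]

theorem IsEvenLevyDensity.exists_isFundamentalSolution {J : Eucl N → ℝ}
    (hJ : IsEvenLevyDensity J) : ∃ μ : ℝ → Measure (Eucl N), IsFundamentalSolution J μ := by
  have h : ∀ t : ℝ, ∃ μ : Measure (Eucl N), 0 < t → IsProbabilityMeasure μ ∧
      ∀ ξ, charFun μ ξ = (Real.exp (-(t * multiplier J ξ)) : ℂ) := by
    intro t
    by_cases ht : 0 < t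
    · obtain ⟨μ, h1, h2⟩ := (hJ.const_mul ht.le).exists_charFun_eq
      exact ⟨μ, fun _ => ⟨h1, fun ξ => by rw [h2, multiplier_const_mul]⟩⟩
    · exact ⟨0, fun h => absurd h ht⟩
  choose μ hμ using h
  exact ⟨μ, hμ⟩

/-! ### Decay of the sup norm. -/

/-- A property that holds almost everywhere holds at `x - y` for `ν`-almost every `y`, for almost
every `x`. -/
theorem ae_ae_sub_of_ae {p : Eucl N → Prop} (hp : ∀ᵐ x, p x) (ν : Measure (Eucl N)) [SFinite ν] :
    ∀ᵐ x, ∀ᵐ y ∂ν, p (x - y) := by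
  obtain ⟨Z, hZ, hZm, hZ0⟩ := exists_measurable_superset_of_null hp
  refine Measure.ae_ae_of_ae_prod (p := fun q : Eucl N × Eucl N => p (q.1 - q.2)) ?_
  have hm : MeasurableSet ((fun q : Eucl N × Eucl N => q.1 - q.2) ⁻¹' Z) :=
    (measurable_fst.sub measurable_snd) hZm
  refine measure_mono_null (t := (fun q : Eucl N × Eucl N => q.1 - q.2) ⁻¹' Z)
    (fun q hq => hZ hq) ?_
  rw [Measure.prod_apply_symm hm]
  refine (lintegral_congr fun y => ?_).trans lintegral_zero
  change volume ((fun x => x - y) ⁻¹' Z) = 0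
  simp_rw [sub_eq_add_neg]
  rw [measure_preimage_add_right, hZ0]

/-- The atom only returns `ν` with a small weight; the rest is dominated by Lebesgue measure, and
translation invariance removes the shift by `x`. -/
theorem lintegral_conv_compoundPoisson_le (ν κ : Measure (Eucl N)) [IsProbabilityMeasure ν]
    [IsFiniteMeasure κ] {C : ℝ≥0∞} (hκ : κ ≤ C • volume) (hpos : κ univ ≠ 0)
    {f : Eucl N → ℝ≥0∞} (hf : Measurable f) :
    ∫⁻ y, f y ∂(ν.conv (compoundPoisson κ)) ≤
      ENNReal.ofReal (Real.exp (-κ.real univ)) * ∫⁻ y, f y ∂ν + C / κ univ * ∫⁻ y, f y := by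
  rw [Measure.lintegral_conv hf]
  calc ∫⁻ x, ∫⁻ y, f (x + y) ∂(compoundPoisson κ) ∂ν
      ≤ ∫⁻ x, (ENNReal.ofReal (Real.exp (-κ.real univ)) * f x + C / κ univ * ∫⁻ y, f y) ∂ν := by
        refine lintegral_mono fun x => ?_
        refine (lintegral_mono' (compoundPoisson_le κ volume hκ hpos) le_rfl).trans_eq ?_
        rw [lintegral_add_measure, lintegral_smul_measure, lintegral_smul_measure,
          lintegral_dirac' _ (by fun_prop), lintegral_add_left_eq_self f x]
        simp
    _ = _ := by
        rw [lintegral_add_left (by fun_prop), lintegral_const_mul _ hf]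
        simp

/-- As `ν` may be singular, a Lebesgue-null set can have positive `ν`-mass. By `ae_ae_sub_of_ae`
this happens for almost no translate, so `f` may be replaced by a measurable representative and
bounded by its essential supremum. -/
theorem eLpNorm_convMeasure_conv_compoundPoisson_le (ν κ : Measure (Eucl N))
    [IsProbabilityMeasure ν] [IsFiniteMeasure κ] {C : ℝ≥0∞} (hκ : κ ≤ C • volume)
    (hpos : κ univ ≠ 0) {f : Eucl N → ℝ} (hf : AEStronglyMeasurable f) :
    eLpNorm (convMeasure f (ν.conv (compoundPoisson κ))) ∞ volume ≤
      ENNReal.ofReal (Real.exp (-κ.real univ)) * eLpNorm f ∞ volume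
        + C / κ univ * eLpNorm f 1 volume := by
  set g := hf.mk f with hg
  have hgm : Measurable g := hf.stronglyMeasurable_mk.measurable
  have hB : ∀ᵐ x, ‖g x‖ₑ ≤ eLpNorm f ∞ volume := by
    filter_upwards [hf.ae_eq_mk, ae_le_eLpNormEssSup (f := f) (μ := volume)] with x h1 h2
    rwa [hg, ← h1, eLpNorm_exponent_top]
  rw [eLpNorm_exponent_top (f := convMeasure _ _)]
  refine essSup_le_of_ae_le _ ?_
  filter_upwards [ae_ae_sub_of_ae hB ν,
    ae_ae_sub_of_ae hf.ae_eq_mk (ν.conv (compoundPoisson κ))] with x hx1 hx2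
  calc ‖convMeasure f (ν.conv (compoundPoisson κ)) x‖ₑ
      ≤ ∫⁻ y, ‖f (x - y)‖ₑ ∂(ν.conv (compoundPoisson κ)) := enorm_integral_le_lintegral_enorm _
    _ = ∫⁻ y, ‖g (x - y)‖ₑ ∂(ν.conv (compoundPoisson κ)) :=
        lintegral_congr_ae (hx2.mono fun y hy => by simp only [hy, hg])
    _ ≤ ENNReal.ofReal (Real.exp (-κ.real univ)) * ∫⁻ y, ‖g (x - y)‖ₑ ∂ν
          + C / κ univ * ∫⁻ y, ‖g (x - y)‖ₑ :=
        lintegral_conv_compoundPoisson_le ν κ hκ hpos (by fun_prop)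
    _ ≤ _ := by
        gcongr
        · refine (lintegral_mono_ae hx1).trans ?_
          simp
        · rw [lintegral_sub_left_eq_self (fun y => ‖g y‖ₑ) x, eLpNorm_one_eq_lintegral_enorm]
          exact (lintegral_congr_ae (hf.ae_eq_mk.mono fun y hy => by rw [hg, hy])).le

/-- If `J ≥ a` on a symmetric set `S` of finite positive measure, then
`‖f * μₜ‖_∞ ≤ exp (-t a |S|) ‖f‖_∞ + |S|⁻¹ ‖f‖₁`. -/
theorem eLpNorm_convMeasure_le {J : Eucl N → ℝ} (hJ : IsEvenLevyDensity J)
    {μ : ℝ → Measure (Eucl N)} (hμ : IsFundamentalSolution J μ) {S : Set (Eucl N)}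
    (hS : MeasurableSet S) (hSneg : ∀ z, -z ∈ S ↔ z ∈ S) (hS0 : volume S ≠ 0)
    (hStop : volume S ≠ ∞) {a : ℝ} (ha : 0 < a) (haJ : ∀ z ∈ S, a ≤ J z)
    {f : Eucl N → ℝ} (hf : AEStronglyMeasurable f) {t : ℝ} (ht : 0 < t) :
    eLpNorm (convMeasure f (μ t)) ∞ volume ≤
      ENNReal.ofReal (Real.exp (-(t * (a * volume.real S)))) * eLpNorm f ∞ volume
        + (volume S)⁻¹ * eLpNorm f 1 volume := by
  let K : Eucl N → ℝ := S.indicator fun _ => t * a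
  have hta : 0 < t * a := mul_pos ht ha
  have hKm : Measurable K := measurable_const.indicator hS
  have hK0 : ∀ z, 0 ≤ K z := fun z => indicator_nonneg (fun _ _ => hta.le) z
  have hKe : ∀ z, K (-z) = K z := fun z => by by_cases hz : z ∈ S <;> simp [K, hz, hSneg]
  have hKi : Integrable K := (integrable_indicator_iff hS).2 (integrableOn_const hStop)
  have htJ := hJ.const_mul ht.le
  have hKle : ∀ z, K z ≤ t * J z := fun z => by
    by_cases hz : z ∈ S
    · simpa only [K, indicator_of_mem hz] using mul_le_mul_of_nonneg_left (haJ z hz) ht.le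
    · simpa only [K, indicator_of_notMem hz] using htJ.nonneg z
  have hK := htJ.mono hKm hK0 hKe hKle
  obtain ⟨ν, hν, hνc⟩ := (htJ.sub hK hKle).exists_charFun_eq
  have hκfin := isFiniteMeasure_densityMeasure hKi
  have hκ : densityMeasure K = ENNReal.ofReal (t * a) • volume.restrict S := by
    have : (fun z => ENNReal.ofReal (K z)) = S.indicator fun _ => ENNReal.ofReal (t * a) := by
      ext z
      by_cases hz : z ∈ S <;> simp [K, hz]
    rw [densityMeasure, this, withDensity_indicator hS, withDensity_const]
  have hκuniv : densityMeasure K univ = ENNReal.ofReal (t * a) * volume S := by simp [hκ]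
  have hta0 : ENNReal.ofReal (t * a) ≠ 0 := by simpa using hta
  -- The multipliers of `t J - K` and `K` add up to that of `t J`, so the characteristic functions
  -- multiply to that of `μ t`.
  have hμt : μ t = ν.conv (compoundPoisson (densityMeasure K)) := by
    have := (hμ t ht).1
    refine Measure.ext_of_charFun (funext fun ξ => ?_)
    rw [(hμ t ht).2, charFun_conv, hνc, charFun_compoundPoisson_densityMeasure hKm hK0 hKe hKi,
      multiplier_sub htJ hK, multiplier_const_mul, ← Complex.ofReal_mul, ← Real.exp_add]
    congr 2
    ring
  rw [hμt]
  refine (eLpNorm_convMeasure_conv_compoundPoisson_le ν (densityMeasure K)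
    (C := ENNReal.ofReal (t * a)) ?_ ?_ hf).trans_eq ?_
  · rw [hκ]
    gcongr
    exact Measure.restrict_le_self
  · rw [hκuniv]
    exact mul_ne_zero hta0 hS0
  · congr 3
    · rw [measureReal_def, hκuniv, ENNReal.toReal_mul, ENNReal.toReal_ofReal hta.le,
        measureReal_def, mul_assoc]
    -- Both the height `t a` and the mass `t a |S|` of `K` grow linearly in `t`; their quotient is
    -- `1 / |S|`.
    · rw [hκuniv, ENNReal.div_eq_inv_mul, ENNReal.mul_inv (.inl hta0) (.inl ENNReal.ofReal_ne_top),
        mul_right_comm, ENNReal.inv_mul_cancel hta0 ENNReal.ofReal_ne_top, one_mul]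

/-- The shells exhaust the complement of a ball, of infinite volume because `N ≥ 1`. -/
theorem tendsto_volume_shell (hN : 1 ≤ N) (R : ℝ) :
    Tendsto (fun n : ℕ => volume (Metric.closedBall (0 : Eucl N) n \ Metric.ball 0 R)) atTop
      (𝓝 ∞) := by
  have : Nonempty (Fin N) := ⟨⟨0, hN⟩⟩
  have h := tendsto_measure_iUnion_atTop (μ := (volume : Measure (Eucl N)))
    (s := fun n : ℕ => Metric.closedBall (0 : Eucl N) n \ Metric.ball 0 R)
    (fun m n hmn => sdiff_subset_sdiff_left (Metric.closedBall_subset_closedBall (by exact_mod_cast hmn)))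
  rw [← iUnion_sdiff, Metric.iUnion_closedBall_nat, ← compl_eq_univ_sdiff,
    measure_compl measurableSet_ball measure_ball_lt_top.ne, measure_univ_of_isAddLeftInvariant,
    ENNReal.top_sub measure_ball_lt_top.ne] at h
  exact h

theorem tendsto_eLpNorm_convMeasure (hN : 1 ≤ N) {J : Eucl N → ℝ} (hJ : IsEvenLevyDensity J)
    {α : ℝ} (hα : 0 < α)
    (htail : ∃ c > 0, ∃ R : ℝ, ∀ z, R ≤ ‖z‖ → c * ‖z‖ ^ (-((N : ℝ) + α)) ≤ J z)
    {μ : ℝ → Measure (Eucl N)} (hμ : IsFundamentalSolution J μ)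
    {f : Eucl N → ℝ} (hf₁ : MemLp f 1 volume) (hf_top : MemLp f ∞ volume) :
    Tendsto (fun t => eLpNorm (convMeasure f (μ t)) ∞ volume) atTop (𝓝 0) := by
  obtain ⟨c, hc, R₀, hR₀⟩ := htail
  -- Radius at least `1` keeps `‖z‖ > 0` on the shells, where the negative power is decreasing.
  set R := max R₀ 1 with hR
  set S : ℕ → Set (Eucl N) := fun n => Metric.closedBall 0 n \ Metric.ball 0 R with hSdef
  have hvol := tendsto_volume_shell hN R
  rw [ENNReal.tendsto_nhds_zero]
  intro ε hε
  have h1 : Tendsto (fun n => (volume (S n))⁻¹ * eLpNorm f 1 volume) atTop (𝓝 0) := by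
    simpa using ENNReal.Tendsto.mul_const (tendsto_inv_iff.2 hvol)
      (.inr hf₁.eLpNorm_ne_top)
  have hε2 : 0 < ε / 2 := ENNReal.half_pos hε.ne'
  -- The shell is fixed before `t`: its volume makes the `L¹` term small uniformly in time.
  obtain ⟨n, ⟨hn1, hn2⟩, hn3⟩ := (((ENNReal.tendsto_nhds_zero.1 h1 _ hε2).and
    (hvol.eventually_ne (ENNReal.top_ne_zero))).and (eventually_ge_atTop 1)).exists
  have hSm : MeasurableSet (S n) := measurableSet_closedBall.diff measurableSet_ball
  have hStop : volume (S n) ≠ ∞ :=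
    ((measure_mono sdiff_subset).trans_lt measure_closedBall_lt_top).ne
  have hn0 : (0 : ℝ) < n := by exact_mod_cast hn3
  -- The value of the tail bound at the outer radius `n`, where it is smallest on the shell.
  set a := c * (n : ℝ) ^ (-((N : ℝ) + α)) with ha
  have ha0 : 0 < a := by positivity
  have haJ : ∀ z ∈ S n, a ≤ J z := by
    intro z hz
    simp only [hSdef, Set.mem_sdiff, mem_closedBall_zero_iff, mem_ball_zero_iff, not_lt] at hz
    refine le_trans ?_ (hR₀ z ((le_max_left _ _).trans hz.2))
    have hz0 : 0 < ‖z‖ := one_pos.trans_le ((le_max_right _ _).trans hz.2)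
    exact mul_le_mul_of_nonneg_left
      (Real.rpow_le_rpow_of_nonpos hz0 hz.1 (by have := N.cast_nonneg (α := ℝ); linarith)) hc.le
  have hV : 0 < a * volume.real (S n) :=
    mul_pos ha0 (ENNReal.toReal_pos hn2 hStop)
  have h2 : Tendsto (fun t : ℝ => ENNReal.ofReal (Real.exp (-(t * (a * volume.real (S n)))))
      * eLpNorm f ∞ volume) atTop (𝓝 0) := by
    have h3 : Tendsto (fun t : ℝ => Real.exp (-(t * (a * volume.real (S n))))) atTop (𝓝 0) :=
      Real.tendsto_exp_neg_atTop_nhds_zero.comp (tendsto_id.atTop_mul_const hV)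
    simpa using ENNReal.Tendsto.mul_const (ENNReal.tendsto_ofReal h3) (.inr hf_top.eLpNorm_ne_top)
  filter_upwards [ENNReal.tendsto_nhds_zero.1 h2 _ hε2, eventually_gt_atTop 0] with t ht1 ht0
  refine (eLpNorm_convMeasure_le hJ hμ hSm (fun z => by simp [hSdef]) hn2 hStop ha0 haJ hf₁.1
    ht0).trans ?_
  rw [← ENNReal.add_halves ε]
  exact add_le_add ht1 hn1

/-! ### Second differences and the Lévy operator. -/

/-- The second difference `2ψ(x) - ψ(x - z) - ψ(x + z)`. -/
def secondDiff (ψ : Eucl N → ℝ) (x z : Eucl N) : ℝ := 2 * ψ x - ψ (x - z) - ψ (x + z)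

/-- The Lévy operator `𝓛ψ(x) = (1/2) ∫ (2ψ(x) - ψ(x - z) - ψ(x + z)) J(z) dz`. -/
noncomputable def levyOp (J ψ : Eucl N → ℝ) (x : Eucl N) : ℝ :=
  2⁻¹ * ∫ z, secondDiff ψ x z * J z

/-- `f` is bounded, Lipschitz and has second differences of quadratic order, with constant `A`. -/
structure HasC11Bound (A : ℝ) (f : Eucl N → ℝ) : Prop where
  bound : ∀ x, |f x| ≤ A
  lipschitz : ∀ x y, |f x - f y| ≤ A * ‖x - y‖
  second : ∀ x z, |secondDiff f x z| ≤ A * ‖z‖ ^ 2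

namespace HasC11Bound

variable {A B : ℝ} {f g : Eucl N → ℝ}

theorem nonneg (hf : HasC11Bound A f) : 0 ≤ A := (abs_nonneg _).trans (hf.bound 0)

theorem continuous (hf : HasC11Bound A f) : Continuous f :=
  (LipschitzWith.of_dist_le_mul (K := ⟨A, hf.nonneg⟩) fun x y => by
    rw [Real.dist_eq, dist_eq_norm]; exact hf.lipschitz x y).continuous

theorem abs_secondDiff_le (hf : HasC11Bound A f) (x z : Eucl N) :
    |secondDiff f x z| ≤ 4 * A * min (‖z‖ ^ 2) 1 := by
  have hA := hf.nonneg
  have h1 := hf.second x z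
  have h2 : |secondDiff f x z| ≤ 4 * A := by
    have := abs_le.1 (hf.bound x)
    have := abs_le.1 (hf.bound (x - z))
    have := abs_le.1 (hf.bound (x + z))
    rw [secondDiff, abs_le]
    constructor <;> linarith
  rcases min_cases (‖z‖ ^ 2) 1 with ⟨h, -⟩ | ⟨h, -⟩ <;> rw [h]
  · nlinarith [sq_nonneg ‖z‖]
  · linarith

theorem sq_sub_le (hf : HasC11Bound A f) (x y : Eucl N) :
    (f x - f y) ^ 2 ≤ 4 * A ^ 2 * min (‖x - y‖ ^ 2) 1 := by
  have hA := hf.nonneg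
  have h1 : (f x - f y) ^ 2 ≤ (A * ‖x - y‖) ^ 2 := by
    rw [← sq_abs (f x - f y)]; gcongr; exact hf.lipschitz x y
  have h2 : (f x - f y) ^ 2 ≤ (2 * A) ^ 2 := by
    rw [← sq_abs (f x - f y)]
    gcongr
    have := abs_le.1 (hf.bound x)
    have := abs_le.1 (hf.bound y)
    rw [abs_le]
    constructor <;> linarith
  rcases min_cases (‖x - y‖ ^ 2) 1 with ⟨h, -⟩ | ⟨h, -⟩ <;> rw [h]
  · nlinarith [sq_nonneg (A * ‖x - y‖)]
  · linarith

theorem mul (hf : HasC11Bound A f) (hg : HasC11Bound B g) :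
    HasC11Bound (4 * A * B) fun x => f x * g x := by
  have hA := hf.nonneg
  have hB := hg.nonneg
  have hAB := mul_nonneg hA hB
  refine ⟨fun x => ?_, fun x y => ?_, fun x z => ?_⟩
  · rw [abs_mul]
    have := mul_le_mul (hf.bound x) (hg.bound x) (abs_nonneg _) hA
    linarith
  · have h : f x * g x - f y * g y = (f x - f y) * g x + f y * (g x - g y) := by ring
    rw [h]
    refine (abs_add_le _ _).trans ?_
    rw [abs_mul, abs_mul]
    have h1 := mul_le_mul (hf.lipschitz x y) (hg.bound x) (abs_nonneg _) (by positivity)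
    have h2 := mul_le_mul (hf.bound y) (hg.lipschitz x y) (abs_nonneg _) hA
    nlinarith [mul_nonneg hAB (norm_nonneg (x - y))]
  -- Product rule for second differences. The two corrections are products of first differences,
  -- hence quadratic in `z` by the Lipschitz bounds; the four terms give the constant `4 * A * B`.
  · have h : secondDiff (fun x => f x * g x) x z = secondDiff f x z * g x + f x * secondDiff g x z
        + -((f (x + z) - f x) * (g (x + z) - g x))
        + -((f (x - z) - f x) * (g (x - z) - g x)) := by
      simp only [secondDiff]; ring
    have hfp := hf.lipschitz (x + z) x
    have hgp := hg.lipschitz (x + z) x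
    have hfm := hf.lipschitz (x - z) x
    have hgm := hg.lipschitz (x - z) x
    rw [add_sub_cancel_left] at hfp hgp
    rw [sub_sub_cancel_left, norm_neg] at hfm hgm
    have h1 := mul_le_mul (hf.second x z) (hg.bound x) (abs_nonneg _) (by positivity)
    have h2 := mul_le_mul (hf.bound x) (hg.second x z) (abs_nonneg _) hA
    have h3 := mul_le_mul hfp hgp (abs_nonneg _) (by positivity)
    have h4 := mul_le_mul hfm hgm (abs_nonneg _) (by positivity)
    rw [h]
    refine (abs_add_le _ _).trans ((add_le_add_left ((abs_add_le _ _).trans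
      (add_le_add_left (abs_add_le _ _) _)) _).trans ?_)
    rw [abs_neg, abs_neg, abs_mul, abs_mul, abs_mul, abs_mul]
    nlinarith

/-- Dilating by `c ≤ 1` only shrinks differences, so the cutoffs `χ (x / (n + 1))` share one
constant. -/
theorem comp_smul (hf : HasC11Bound A f) {c : ℝ} (hc0 : 0 ≤ c) (hc1 : c ≤ 1) :
    HasC11Bound A fun x => f (c • x) := by
  have hA := hf.nonneg
  refine ⟨fun x => hf.bound _, fun x y => (hf.lipschitz _ _).trans ?_, fun x z => ?_⟩
  · rw [← smul_sub, norm_smul, Real.norm_of_nonneg hc0]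
    gcongr
    exact mul_le_of_le_one_left (norm_nonneg _) hc1
  · have h : secondDiff (fun x => f (c • x)) x z = secondDiff f (c • x) (c • z) := by
      simp only [secondDiff, smul_sub, smul_add]
    rw [h]
    refine (hf.second _ _).trans ?_
    rw [norm_smul, Real.norm_of_nonneg hc0]
    gcongr
    exact mul_le_of_le_one_left (norm_nonneg _) hc1

end HasC11Bound

theorem exists_hasC11Bound_of_contDiff {f : Eucl N → ℝ} (hf : ContDiff ℝ 2 f)
    (hc : HasCompactSupport f) : ∃ A, HasC11Bound A f := by
  obtain ⟨A₀, hA₀⟩ := hf.continuous.bounded_above_of_compact_support hc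
  obtain ⟨A₁, hA₁⟩ := hf.lipschitzWith_of_hasCompactSupport hc two_ne_zero
  obtain ⟨A₂, hA₂⟩ := (hf.fderiv_right (m := 1) (by norm_num)).lipschitzWith_of_hasCompactSupport
    (hc.fderiv ℝ) one_ne_zero
  have hA₀' : 0 ≤ A₀ := (norm_nonneg _).trans (hA₀ 0)
  have hd : Differentiable ℝ f := hf.differentiable two_ne_zero
  refine ⟨A₀ + A₁ + 2 * A₂, fun x => ?_, fun x y => ?_, fun x z => ?_⟩
  · have := hA₀ x
    rw [Real.norm_eq_abs] at this
    linarith [A₁.2, A₂.2]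
  · have := hA₁.dist_le_mul x y
    rw [Real.dist_eq, dist_eq_norm] at this
    refine this.trans ?_
    gcongr
    linarith [A₁.2, A₂.2]
  -- The derivative of `h` at `w` is a difference of values of `fderiv ℝ f` at points `2 w` apart,
  -- hence at most `2 * A₂ * ‖w‖`; the mean value inequality on the ball of radius `‖z‖` gives a
  -- quadratic bound.
  · let h : Eucl N → ℝ := fun w => f (x + w) + f (x - w)
    have hder : ∀ w, HasFDerivAt h (fderiv ℝ f (x + w) - fderiv ℝ f (x - w)) w := by
      intro w
      have h1 : HasFDerivAt (fun w => f (x + w)) (fderiv ℝ f (x + w)) w := by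
        exact ((hd (x + w)).hasFDerivAt.comp w ((hasFDerivAt_id w).const_add x)).congr_fderiv
          (by ext; simp)
      have h2 : HasFDerivAt (fun w => f (x - w)) (-fderiv ℝ f (x - w)) w := by
        exact ((hd (x - w)).hasFDerivAt.comp w ((hasFDerivAt_id w).const_sub x)).congr_fderiv
          (by ext; simp)
      exact (h1.add h2).congr_fderiv (by ext; simp [sub_eq_add_neg])
    have hle : ∀ w ∈ Metric.closedBall (0 : Eucl N) ‖z‖,
        ‖fderiv ℝ h w‖ ≤ 2 * A₂ * ‖z‖ := by
      intro w hw
      rw [mem_closedBall_zero_iff] at hw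
      rw [(hder w).fderiv, ← dist_eq_norm]
      refine (hA₂.dist_le_mul _ _).trans ?_
      rw [dist_eq_norm, add_sub_sub_cancel, ← two_smul ℝ w, norm_smul, Real.norm_two]
      have := mul_le_mul_of_nonneg_left hw A₂.2
      simp only [NNReal.val_eq_coe] at this
      linarith
    have := (convex_closedBall (0 : Eucl N) ‖z‖).norm_image_sub_le_of_norm_fderiv_le
      (fun w _ => (hder w).differentiableAt) hle (Metric.mem_closedBall_self (norm_nonneg z))
      (mem_closedBall_zero_iff.2 le_rfl)
    have heq : secondDiff f x z = -(h z - h 0) := by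
      simp only [secondDiff, h, add_zero, sub_zero]; ring
    rw [heq, abs_neg, ← Real.norm_eq_abs]
    refine this.trans ?_
    rw [sub_zero]
    nlinarith [sq_nonneg ‖z‖, A₁.2, A₂.2, mul_nonneg hA₀' (sq_nonneg ‖z‖),
      mul_nonneg A₁.2 (sq_nonneg ‖z‖)]

/-- The dependence on `x` factors out, which makes cosines eigenfunctions of `levyOp`. The phase `b`
covers sines as well. -/
theorem secondDiff_cos (ξ : Eucl N) (b : ℝ) (x z : Eucl N) :
    secondDiff (fun x => Real.cos (inner ℝ x ξ + b)) x z
      = 2 * Real.cos (inner ℝ x ξ + b) * (1 - Real.cos (inner ℝ z ξ)) := by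
  simp only [secondDiff, inner_sub_left, inner_add_left]
  have h1 : inner ℝ x ξ - inner ℝ z ξ + b = (inner ℝ x ξ + b) - inner ℝ z ξ := by ring
  have h2 : inner ℝ x ξ + inner ℝ z ξ + b = (inner ℝ x ξ + b) + inner ℝ z ξ := by ring
  rw [h1, h2]
  generalize inner ℝ x ξ + b = p
  rw [Real.cos_sub, Real.cos_add]
  ring

theorem hasC11Bound_cos (ξ : Eucl N) (b : ℝ) :
    HasC11Bound (1 + ‖ξ‖ ^ 2) fun x => Real.cos (inner ℝ x ξ + b) := by
  refine ⟨fun x => (Real.abs_cos_le_one _).trans (by nlinarith [sq_nonneg ‖ξ‖]),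
    fun x y => ?_, fun x z => ?_⟩
  · have h1 := Real.lipschitzWith_cos.dist_le_mul (inner ℝ x ξ + b) (inner ℝ y ξ + b)
    rw [Real.dist_eq, Real.dist_eq, add_sub_add_right_eq_sub, ← inner_sub_left] at h1
    have h2 := abs_real_inner_le_norm (x - y) ξ
    simp only [NNReal.coe_one, one_mul] at h1
    nlinarith [norm_nonneg (x - y), sq_nonneg (‖ξ‖ - 1), norm_nonneg ξ]
  · have h3 := Real.one_sub_sq_div_two_le_cos (x := inner ℝ z ξ)
    have h4 : (inner ℝ z ξ) ^ 2 ≤ (‖z‖ * ‖ξ‖) ^ 2 := by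
      rw [← sq_abs (inner ℝ z ξ)]
      gcongr
      exact abs_real_inner_le_norm z ξ
    rw [secondDiff_cos, abs_mul, abs_mul, abs_of_nonneg (one_sub_cos_inner_nonneg z ξ), abs_two]
    have h5 := Real.abs_cos_le_one (inner ℝ x ξ + b)
    have h6 := one_sub_cos_inner_nonneg z ξ
    calc 2 * |Real.cos (inner ℝ x ξ + b)| * (1 - Real.cos (inner ℝ z ξ))
        ≤ 2 * 1 * (1 - Real.cos (inner ℝ z ξ)) := by gcongr
      _ ≤ (1 + ‖ξ‖ ^ 2) * ‖z‖ ^ 2 := by nlinarith [sq_nonneg ‖z‖]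

section LevyOp

variable {J : Eucl N → ℝ}

theorem levyOp_cos (J : Eucl N → ℝ) (ξ : Eucl N) (b : ℝ) (x : Eucl N) :
    levyOp J (fun x => Real.cos (inner ℝ x ξ + b)) x
      = multiplier J ξ * Real.cos (inner ℝ x ξ + b) := by
  simp only [levyOp, secondDiff_cos, multiplier, mul_assoc]
  rw [integral_const_mul, integral_const_mul]
  ring

theorem measurable_levyOp (hJ : IsEvenLevyDensity J) {ψ : Eucl N → ℝ} (hψ : Continuous ψ) :
    Measurable (levyOp J ψ) := by
  have hJm := hJ.measurable
  have h : Measurable fun p : Eucl N × Eucl N => secondDiff ψ p.1 p.2 * J p.2 := by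
    unfold secondDiff
    have := hψ.measurable
    fun_prop
  exact (h.stronglyMeasurable.integral_prod_right').measurable.const_mul _

theorem HasC11Bound.norm_levyOp_integrand_le {A : ℝ} {ψ : Eucl N → ℝ} (hψ : HasC11Bound A ψ)
    (hJ : IsEvenLevyDensity J) (x z : Eucl N) :
    ‖secondDiff ψ x z * J z‖ ≤ 4 * A * (J z * min (‖z‖ ^ 2) 1) := by
  rw [norm_mul, Real.norm_of_nonneg (hJ.nonneg z), Real.norm_eq_abs]
  nlinarith [mul_le_mul_of_nonneg_right (hψ.abs_secondDiff_le x z) (hJ.nonneg z)]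

theorem HasC11Bound.abs_levyOp_le {A : ℝ} {ψ : Eucl N → ℝ} (hψ : HasC11Bound A ψ)
    (hJ : IsEvenLevyDensity J) (x : Eucl N) :
    |levyOp J ψ x| ≤ 2⁻¹ * ∫ z, 4 * A * (J z * min (‖z‖ ^ 2) 1) := by
  rw [levyOp, abs_mul, abs_of_pos (by norm_num : (0 : ℝ) < 2⁻¹)]
  gcongr
  exact norm_integral_le_of_norm_le (hJ.integrable.const_mul _)
    (ae_of_all _ fun z => hψ.norm_levyOp_integrand_le hJ x z)

theorem tendsto_levyOp (hJ : IsEvenLevyDensity J) {A : ℝ} {ψ : ℕ → Eucl N → ℝ}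
    {φ : Eucl N → ℝ} (hψ : ∀ n, HasC11Bound A (ψ n))
    (hlim : ∀ x, Tendsto (fun n => ψ n x) atTop (𝓝 (φ x))) (x : Eucl N) :
    Tendsto (fun n => levyOp J (ψ n) x) atTop (𝓝 (levyOp J φ x)) := by
  refine Tendsto.const_mul _ (tendsto_integral_of_dominated_convergence
    (fun z => 4 * A * (J z * min (‖z‖ ^ 2) 1)) (fun n => ?_) (hJ.integrable.const_mul _)
    (fun n => ae_of_all _ fun z => (hψ n).norm_levyOp_integrand_le hJ x z)
    (ae_of_all _ fun z => ?_))
  · have := hJ.measurable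
    have := (hψ n).continuous
    unfold secondDiff
    fun_prop
  · exact ((((hlim x).const_mul 2).sub (hlim _)).sub (hlim _)).mul_const _

end LevyOp

/-! ### The Dirichlet form and integration by parts. -/

section Energy

variable {J : Eucl N → ℝ}

theorem integrable_energy (hJ : IsEvenLevyDensity J) {f : Eucl N → ℝ}
    (hf : AEStronglyMeasurable f) (h : energy J f < ∞) :
    Integrable fun p : Eucl N × Eucl N => (f p.1 - f p.2) ^ 2 * J (p.1 - p.2) := by
  have hJm := hJ.measurable
  have hm : AEStronglyMeasurable (fun p : Eucl N × Eucl N => (f p.1 - f p.2) ^ 2 * J (p.1 - p.2)) :=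
    ((hf.comp_fst.sub hf.comp_snd).pow 2).mul
      (Measurable.aestronglyMeasurable (by fun_prop))
  refine (lintegral_ofReal_ne_top_iff_integrable hm
    (ae_of_all _ fun p => mul_nonneg (sq_nonneg _) (hJ.nonneg _))).1 fun htop => ?_
  rw [energy, htop, ENNReal.mul_top (by simp)] at h
  exact lt_irrefl _ h

/-- The integrand vanishes unless `x` or `y` lies in the ball `B`; in each case integrating out the
other variable leaves the finite Lévy integral, times the volume of `B`. -/
theorem HasC11Bound.energy_lt_top {A : ℝ} {ψ : Eucl N → ℝ} (hψ : HasC11Bound A ψ)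
    (hJ : IsEvenLevyDensity J) {r : ℝ} (hr : ∀ x, r ≤ ‖x‖ → ψ x = 0) : energy J ψ < ∞ := by
  have hJm := hJ.measurable
  set B : Set (Eucl N) := Metric.ball 0 r
  set h : Eucl N → ℝ≥0∞ := fun z => ENNReal.ofReal (4 * A ^ 2 * (J z * min (‖z‖ ^ 2) 1)) with hh
  have hhm : Measurable h := by fun_prop
  have hh_top : ∫⁻ z, h z ≠ ∞ := (hJ.integrable.const_mul (4 * A ^ 2)).lintegral_lt_top.ne
  have hB : Measurable (B.indicator (1 : Eucl N → ℝ≥0∞)) :=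
    measurable_one.indicator measurableSet_ball
  have hBtop : volume B ≠ ∞ := measure_ball_lt_top.ne
  refine ENNReal.mul_lt_top (by simp) ?_
  calc ∫⁻ p : Eucl N × Eucl N, ENNReal.ofReal ((ψ p.1 - ψ p.2) ^ 2 * J (p.1 - p.2))
      ≤ ∫⁻ p : Eucl N × Eucl N, (B.indicator 1 p.1 * h (p.1 - p.2)
          + B.indicator 1 p.2 * h (p.1 - p.2)) := by
        refine lintegral_mono fun p => ?_
        have hle : ENNReal.ofReal ((ψ p.1 - ψ p.2) ^ 2 * J (p.1 - p.2)) ≤ h (p.1 - p.2) := by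
          refine ENNReal.ofReal_le_ofReal ?_
          nlinarith [mul_le_mul_of_nonneg_right (hψ.sq_sub_le p.1 p.2) (hJ.nonneg (p.1 - p.2))]
        by_cases h1 : p.1 ∈ B
        · simpa [h1] using hle.trans le_self_add
        by_cases h2 : p.2 ∈ B
        · simpa [h2] using hle.trans le_add_self
        rw [mem_ball_zero_iff, not_lt] at h1 h2
        simp [hr _ h1, hr _ h2]
    _ = volume B * (∫⁻ z, h z) + volume B * ∫⁻ z, h z := by
        have h1 : ∀ x, ∫⁻ y, B.indicator 1 x * h (x - y) = B.indicator 1 x * ∫⁻ z, h z := fun x => by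
          rw [lintegral_const_mul _ (by fun_prop), lintegral_sub_left_eq_self h]
        have h2 : ∀ y, ∫⁻ x, B.indicator 1 y * h (x - y) = B.indicator 1 y * ∫⁻ z, h z := fun y => by
          rw [lintegral_const_mul _ (by fun_prop), lintegral_sub_right_eq_self h]
        rw [lintegral_add_left (by fun_prop), Measure.volume_eq_prod,
          lintegral_prod _ (by fun_prop), lintegral_prod_symm _ (by fun_prop),
          lintegral_congr h1, lintegral_congr h2, lintegral_mul_const _ hB,
          lintegral_indicator_one measurableSet_ball]
    _ < ∞ := by
        exact ENNReal.add_lt_top.2 ⟨ENNReal.mul_lt_top hBtop.lt_top hh_top.lt_top,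
          ENNReal.mul_lt_top hBtop.lt_top hh_top.lt_top⟩

theorem integrable_dirichletForm (hJ : IsEvenLevyDensity J) {f g : Eucl N → ℝ}
    (hf : AEStronglyMeasurable f) (hg : AEStronglyMeasurable g)
    (hfe : energy J f < ∞) (hge : energy J g < ∞) :
    Integrable fun p : Eucl N × Eucl N =>
      (f p.1 - f p.2) * (g p.1 - g p.2) * J (p.1 - p.2) := by
  have hJm := hJ.measurable
  refine ((integrable_energy hJ hf hfe).add (integrable_energy hJ hg hge)).mono'
    (((hf.comp_fst.sub hf.comp_snd).mul (hg.comp_fst.sub hg.comp_snd)).mul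
      (Measurable.aestronglyMeasurable (by fun_prop))) (ae_of_all _ fun p => ?_)
  rw [norm_mul, Real.norm_of_nonneg (hJ.nonneg _), Pi.add_apply, ← add_mul]
  refine mul_le_mul_of_nonneg_right ?_ (hJ.nonneg _)
  rw [Real.norm_eq_abs, abs_le]
  constructor <;> nlinarith [sq_nonneg (f p.1 - f p.2 + (g p.1 - g p.2)),
    sq_nonneg (f p.1 - f p.2 - (g p.1 - g p.2)), sq_nonneg (f p.1 - f p.2),
    sq_nonneg (g p.1 - g p.2)]

/-- Integration by parts at a fixed increment `z`. -/
theorem integral_mul_sub_add_eq {u ψ : Eucl N → ℝ} (hu : Integrable u) {A : ℝ}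
    (hψ : HasC11Bound A ψ) (z : Eucl N) :
    ∫ x, (u x - u (x + z)) * (ψ x - ψ (x + z)) = ∫ x, u x * secondDiff ψ x z := by
  have hc := hψ.continuous
  have hb : ∀ x y, ‖ψ x - ψ y‖ ≤ 2 * A := fun x y => by
    have := abs_le.1 (hψ.bound x)
    have := abs_le.1 (hψ.bound y)
    rw [Real.norm_eq_abs, abs_le]
    constructor <;> linarith
  have h1 : Integrable fun x => u x * (ψ x - ψ (x + z)) :=
    hu.mul_bdd (c := 2 * A) (by fun_prop) (ae_of_all _ fun x => hb _ _)
  have h2 : Integrable fun x => u x * (ψ (x - z) - ψ x) :=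
    hu.mul_bdd (c := 2 * A) (by fun_prop) (ae_of_all _ fun x => hb _ _)
  have h3 : Integrable fun x => u (x + z) * (ψ x - ψ (x + z)) := by
    simpa using h2.comp_add_right z
  have h4 : ∫ x, u (x + z) * (ψ x - ψ (x + z)) = ∫ x, u x * (ψ (x - z) - ψ x) := by
    rw [← integral_add_right_eq_self (fun x => u x * (ψ (x - z) - ψ x)) z]
    simp
  calc ∫ x, (u x - u (x + z)) * (ψ x - ψ (x + z))
      = (∫ x, u x * (ψ x - ψ (x + z))) - ∫ x, u (x + z) * (ψ x - ψ (x + z)) := by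
        rw [← integral_sub h1 h3]
        exact integral_congr_ae (ae_of_all _ fun x => by ring)
    _ = ∫ x, u x * secondDiff ψ x z := by
        rw [h4, ← integral_sub h1 h2]
        exact integral_congr_ae (ae_of_all _ fun x => by simp only [secondDiff]; ring)

/-- In the variables `(x, z)` with `y = x + z`, integration by parts takes place in `x` at fixed
`z`, since the singularity of `J` forbids splitting the double integral. Finite energies justify the
first exchange of integrals; `u ∈ L¹` and the quadratic bound on `secondDiff` justify the exchange
back. -/
theorem dirichletForm_eq_integral_levyOp (hJ : IsEvenLevyDensity J) {u ψ : Eucl N → ℝ}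
    (hu : Integrable u) (hue : energy J u < ∞) {A : ℝ} (hψ : HasC11Bound A ψ)
    (hψe : energy J ψ < ∞) : dirichletForm J u ψ = ∫ x, u x * levyOp J ψ x := by
  have hJm := hJ.measurable
  have hc := hψ.continuous
  have hF := integrable_dirichletForm hJ hu.1 hc.aestronglyMeasurable hue hψe
  have hT : MeasurePreserving (fun p : Eucl N × Eucl N => (p.1, p.1 + p.2))
      ((volume : Measure (Eucl N)).prod volume) ((volume : Measure (Eucl N)).prod volume) :=
    measurePreserving_prod_add volume volume
  have hTe : MeasurableEmbedding (fun p : Eucl N × Eucl N => (p.1, p.1 + p.2)) :=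
    (MeasurableEquiv.shearAddRight (Eucl N)).measurableEmbedding
  rw [Measure.volume_eq_prod] at hF
  have hG : Integrable (fun p : Eucl N × Eucl N =>
      (u p.1 - u (p.1 + p.2)) * (ψ p.1 - ψ (p.1 + p.2)) * J p.2)
      ((volume : Measure (Eucl N)).prod volume) := by
    refine (hT.integrable_comp_of_integrable hF).congr (ae_of_all _ fun p => ?_)
    simp [hJ.even]
  have hD : Integrable (fun p : Eucl N × Eucl N => u p.1 * (secondDiff ψ p.1 p.2 * J p.2))
      ((volume : Measure (Eucl N)).prod volume) := by
    have hb := (hu.norm.mul_prod (hJ.integrable.const_mul (4 * A)))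
    refine hb.mono' (hu.1.comp_fst.mul (Measurable.aestronglyMeasurable ?_))
      (ae_of_all _ fun p => ?_)
    · have := hc.measurable
      unfold secondDiff
      fun_prop
    · rw [norm_mul]
      exact mul_le_mul_of_nonneg_left (hψ.norm_levyOp_integrand_le hJ _ _) (norm_nonneg _)
  have hstep : ∫ p : Eucl N × Eucl N, (u p.1 - u p.2) * (ψ p.1 - ψ p.2) * J (p.1 - p.2)
      = ∫ x, ∫ z, u x * (secondDiff ψ x z * J z) := by
    rw [Measure.volume_eq_prod, ← hT.integral_comp hTe]
    calc ∫ p : Eucl N × Eucl N, (u p.1 - u (p.1 + p.2)) * (ψ p.1 - ψ (p.1 + p.2))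
          * J (p.1 - (p.1 + p.2)) ∂((volume : Measure (Eucl N)).prod volume)
        = ∫ p : Eucl N × Eucl N, (u p.1 - u (p.1 + p.2)) * (ψ p.1 - ψ (p.1 + p.2)) * J p.2
            ∂((volume : Measure (Eucl N)).prod volume) :=
          integral_congr_ae (ae_of_all _ fun p => by simp [hJ.even])
      _ = ∫ z, ∫ x, (u x - u (x + z)) * (ψ x - ψ (x + z)) * J z := integral_prod_symm _ hG
      _ = ∫ z, ∫ x, u x * (secondDiff ψ x z * J z) := by
          refine integral_congr_ae (ae_of_all _ fun z => ?_)
          simp only [← mul_assoc]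
          rw [integral_mul_const, integral_mul_const, integral_mul_sub_add_eq hu hψ]
      _ = ∫ x, ∫ z, u x * (secondDiff ψ x z * J z) := (integral_integral_swap hD).symm
  rw [dirichletForm, hstep, ← integral_const_mul]
  refine integral_congr_ae (ae_of_all _ fun x => ?_)
  simp only [levyOp]
  rw [integral_const_mul]
  ring

theorem dirichletForm_const_mul_right (J f g : Eucl N → ℝ) (c : ℝ) :
    dirichletForm J f (fun x => c * g x) = c * dirichletForm J f g := by
  rw [dirichletForm, dirichletForm, mul_left_comm, ← integral_const_mul c]
  congr 1
  exact integral_congr_ae (ae_of_all _ fun p => by ring)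

theorem energy_congr_ae (J : Eucl N → ℝ) {f g : Eucl N → ℝ} (h : f =ᵐ[volume] g) :
    energy J f = energy J g := by
  rw [energy, energy]
  congr 1
  refine lintegral_congr_ae ?_
  rw [Measure.volume_eq_prod]
  filter_upwards [Measure.quasiMeasurePreserving_fst.ae_eq_comp h,
    Measure.quasiMeasurePreserving_snd.ae_eq_comp h] with p h1 h2
  simp only [Function.comp_apply] at h1 h2
  rw [h1, h2]

end Energy

/-! ### Cutoffs and the weak equation tested against cosines. -/

theorem exists_cutoff (N : ℕ) : ∃ (A : ℝ) (χ : ℕ → Eucl N → ℝ),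
    (∀ n, ContDiff ℝ 1 (χ n) ∧ HasC11Bound A (χ n) ∧ ∃ r, ∀ x, r ≤ ‖x‖ → χ n x = 0) ∧
      ∀ x, Tendsto (fun n => χ n x) atTop (𝓝 1) := by
  let b : ContDiffBump (0 : Eucl N) := ⟨1, 2, one_pos, one_lt_two⟩
  obtain ⟨A, hA⟩ := exists_hasC11Bound_of_contDiff (b.contDiff (n := 2)) b.hasCompactSupport
  refine ⟨A, fun n x => b ((1 / ((n : ℝ) + 1)) • x), fun n => ⟨?_, ?_, ⟨2 * (n + 1), ?_⟩⟩, ?_⟩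
  · exact b.contDiff.comp (contDiff_const_smul _)
  · refine hA.comp_smul (by positivity) ?_
    rw [div_le_one (by positivity)]
    linarith [n.cast_nonneg (α := ℝ)]
  · intro x hx
    refine b.zero_of_le_dist ?_
    rw [dist_zero_right, norm_smul, Real.norm_of_nonneg (by positivity), one_div_mul_eq_div,
      le_div_iff₀ (by positivity)]
    exact hx
  · intro x
    have h1 : Tendsto (fun n : ℕ => (1 / ((n : ℝ) + 1)) • x) atTop (𝓝 0) := by
      simpa using (tendsto_one_div_add_atTop_nhds_zero_nat (𝕜 := ℝ)).smul_const x
    have h2 := (b.continuous.tendsto 0).comp h1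
    rwa [b.one_of_mem_closedBall (Metric.mem_closedBall_self b.rIn_pos.le)] at h2

theorem measurable_energy {J : Eucl N → ℝ} (hJ : Measurable J) {u : ℝ × Eucl N → ℝ}
    (hu : Measurable u) : Measurable fun t => energy J fun x => u (t, x) := by
  refine Measurable.const_mul ?_ _
  exact Measurable.lintegral_prod_right'
    (f := fun q : ℝ × (Eucl N × Eucl N) =>
      ENNReal.ofReal ((u (q.1, q.2.1) - u (q.1, q.2.2)) ^ 2 * J (q.2.1 - q.2.2))) (by fun_prop)

namespace IsWeakSolution

variable {J u₀ : Eucl N → ℝ} {u : ℝ → Eucl N → ℝ}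

theorem ae_energy_lt_top (hu : IsWeakSolution J u₀ u) (hJ : Measurable J) {T : ℝ} (hT : 0 < T) :
    ∀ᵐ t ∂(volume.restrict (Ioo 0 T)), energy J (u t) < ∞ := by
  have hm := (hu.integrable T hT).1
  -- Measurability of the energy in `t` comes from a jointly measurable representative of `u`.
  have hae : ∀ᵐ t ∂(volume.restrict (Ioo 0 T)), energy J (u t)
      = energy J fun x => hm.mk _ (t, x) := by
    filter_upwards [Measure.ae_ae_of_ae_prod hm.ae_eq_mk] with t ht
    exact energy_congr_ae J ht
  have hlt : ∫⁻ t in Ioo 0 T, energy J (u t) ≠ ∞ :=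
    ((lintegral_mono fun t => le_add_self).trans_lt (hu.memL2H T hT)).ne
  exact ae_lt_top' ((measurable_energy hJ hm.stronglyMeasurable_mk.measurable).aemeasurable.congr
    (hae.mono fun t ht => ht.symm)) hlt

theorem ae_integrable (hu : IsWeakSolution J u₀ u) {T : ℝ} (hT : 0 < T) :
    ∀ᵐ t ∂(volume.restrict (Ioo 0 T)), Integrable (u t) :=
  (hu.integrable T hT).prod_right_ae

/-- The weak equation against `θ(t) ψ(x)`. -/
theorem weak_eq_mul (hu : IsWeakSolution J u₀ u) (hJ : IsEvenLevyDensity J) {θ : ℝ → ℝ}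
    (hθ : ContDiff ℝ 1 θ) {T : ℝ} (hT : 0 < T) (hθT : ∀ t, T ≤ t → θ t = 0) {ψ : Eucl N → ℝ}
    (hψ : ContDiff ℝ 1 ψ) {A : ℝ} (hψA : HasC11Bound A ψ) {r : ℝ}
    (hψr : ∀ x, r ≤ ‖x‖ → ψ x = 0) :
    (∫ p : ℝ × Eucl N, u p.1 p.2 * (deriv θ p.1 * ψ p.2 - θ p.1 * levyOp J ψ p.2)
      ∂((volume.restrict (Ioo 0 (T + 1))).prod volume)) + θ 0 * ∫ x, ψ x * u₀ x = 0 := by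
  have hT1 : 0 < T + 1 := by linarith
  have hP := hu.integrable (T + 1) hT1
  have hφ : IsTestFunction (fun p : ℝ × Eucl N => θ p.1 * ψ p.2) := by
    refine ⟨(hθ.comp contDiff_fst).mul (hψ.comp contDiff_snd), max T r, fun t x h => ?_⟩
    rcases h with h | h
    · simp [hθT t ((le_max_left _ _).trans h)]
    · simp [hψr x ((le_max_right _ _).trans h)]
  have hw := hu.weak_eq _ hφ
  have hθc : Continuous θ := hθ.continuous
  have hθ'c : Continuous (deriv θ) := hθ.continuous_deriv le_rfl
  -- The margin beyond `T` makes `θ` vanish in a neighbourhood of `t`.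
  have hd0 : ∀ t, T + 1 ≤ t → deriv θ t = 0 := by
    intro t ht
    have : θ =ᶠ[𝓝 t] fun _ => 0 := by
      filter_upwards [lt_mem_nhds (by linarith : T < t)] with s hs using hθT s hs.le
    rw [this.deriv_eq, deriv_const]
  have hderiv : ∀ t x, deriv (fun s => θ s * ψ x) t = deriv θ t * ψ x := fun t x =>
    deriv_mul_const (hθ.differentiable one_ne_zero t) _
  have hsub : ∀ F : ℝ → ℝ, (∀ t, T + 1 ≤ t → F t = 0) →
      ∫ t in Ioi (0 : ℝ), F t = ∫ t in Ioo 0 (T + 1), F t := by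
    intro F hF
    refine (setIntegral_eq_of_subset_of_forall_sdiff_eq_zero measurableSet_Ioi
      Ioo_subset_Ioi_self fun t ht => hF t ?_)
    by_contra hlt
    exact ht.2 ⟨ht.1, not_le.1 hlt⟩
  have hbdd : ∀ f : ℝ → ℝ, Continuous f → ∃ C, ∀ t ∈ Ioo 0 (T + 1), |f t| ≤ C := by
    intro f hf
    obtain ⟨C, hC⟩ := (isCompact_Icc (a := (0 : ℝ)) (b := T + 1)).exists_bound_of_continuousOn
      hf.continuousOn
    exact ⟨C, fun t ht => hC t (Ioo_subset_Icc_self ht)⟩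
  have hint : ∀ (f : ℝ → ℝ) (g : Eucl N → ℝ) (B : ℝ), Continuous f → Measurable g →
      (∀ x, |g x| ≤ B) → Integrable (fun p : ℝ × Eucl N => u p.1 p.2 * (f p.1 * g p.2))
        ((volume.restrict (Ioo 0 (T + 1))).prod volume) := by
    intro f g B hf hg hB
    obtain ⟨C, hC⟩ := hbdd f hf
    refine hP.mul_bdd (c := C * B) ?_ ?_
    · have := hf.measurable
      exact Measurable.aestronglyMeasurable (by fun_prop)
    · have : ∀ᵐ t ∂(volume.restrict (Ioo 0 (T + 1))), |f t| ≤ C :=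
        (ae_restrict_iff' measurableSet_Ioo).2 (ae_of_all _ hC)
      filter_upwards [Measure.quasiMeasurePreserving_fst.ae this] with p hp
      rw [norm_mul]
      exact mul_le_mul hp (hB _) (norm_nonneg _) ((abs_nonneg _).trans hp)
  have h1 := hint (deriv θ) ψ A hθ'c hψA.continuous.measurable hψA.bound
  have h2 := hint θ (levyOp J ψ) _ hθc (measurable_levyOp hJ hψA.continuous)
    (hψA.abs_levyOp_le hJ)
  have e1 : ∫ t in Ioi (0 : ℝ), ∫ x, u t x * deriv (fun s => θ s * ψ x) t
      = ∫ p : ℝ × Eucl N, u p.1 p.2 * (deriv θ p.1 * ψ p.2)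
        ∂((volume.restrict (Ioo 0 (T + 1))).prod volume) := by
    rw [integral_prod _ h1, hsub _ fun t ht => by simp [hderiv, hd0 t ht]]
    simp_rw [hderiv]
  have e2 : ∫ t in Ioi (0 : ℝ), dirichletForm J (u t) (fun x => θ t * ψ x)
      = ∫ p : ℝ × Eucl N, u p.1 p.2 * (θ p.1 * levyOp J ψ p.2)
        ∂((volume.restrict (Ioo 0 (T + 1))).prod volume) := by
    rw [integral_prod _ h2, hsub _ fun t ht => by
      rw [dirichletForm_const_mul_right, hθT t (by linarith), zero_mul]]
    refine integral_congr_ae ?_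
    filter_upwards [hu.ae_energy_lt_top hJ.measurable hT1, hu.ae_integrable hT1] with t ht1 ht2
    rw [dirichletForm_const_mul_right, dirichletForm_eq_integral_levyOp hJ ht2 ht1 hψA
      (hψA.energy_lt_top hJ hψr), ← integral_const_mul]
    exact integral_congr_ae (ae_of_all _ fun x => by ring)
  have e3 : ∫ x, θ 0 * ψ x * u₀ x = θ 0 * ∫ x, ψ x * u₀ x := by
    simp_rw [mul_assoc]
    exact integral_const_mul _ _
  simp only at hw
  rw [e1, e2, e3] at hw
  simp_rw [mul_sub]
  rw [integral_sub h1 h2]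
  linarith

/-- The weak equation against `θ(t) cos(x · ξ + b)`. -/
theorem weak_eq_cos (hu : IsWeakSolution J u₀ u) (hJ : IsEvenLevyDensity J)
    (hu₀ : Integrable u₀) {θ : ℝ → ℝ}
    (hθ : ContDiff ℝ 1 θ) {T : ℝ} (hT : 0 < T) (hθT : ∀ t, T ≤ t → θ t = 0)
    (ξ : Eucl N) (b : ℝ) :
    (∫ t in Ioo 0 (T + 1), (deriv θ t - multiplier J ξ * θ t) *
      ∫ x, u t x * Real.cos (inner ℝ x ξ + b)) +
      θ 0 * ∫ x, u₀ x * Real.cos (inner ℝ x ξ + b) = 0 := by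
  have hT1 : 0 < T + 1 := by linarith
  have hP := hu.integrable (T + 1) hT1
  obtain ⟨A, χ, hχ, hχlim⟩ := exists_cutoff N
  set e : Eucl N → ℝ := fun x => Real.cos (inner ℝ x ξ + b) with he
  have hee := hasC11Bound_cos ξ b
  set ψ : ℕ → Eucl N → ℝ := fun n x => χ n x * e x with hψdef
  set B := 4 * A * (1 + ‖ξ‖ ^ 2) with hB
  -- One constant for all `n`: it bounds `ψ n` and `levyOp J (ψ n)` uniformly, so `u ∈ L¹` suffices
  -- for dominated convergence when the cutoff is removed.
  have hψA : ∀ n, HasC11Bound B (ψ n) := fun n => (hχ n).2.1.mul hee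
  have hψc : ∀ n, ContDiff ℝ 1 (ψ n) := fun n =>
    (hχ n).1.mul (Real.contDiff_cos.comp ((contDiff_id.inner ℝ contDiff_const).add contDiff_const))
  have hψlim : ∀ x, Tendsto (fun n => ψ n x) atTop (𝓝 (e x)) := fun x => by
    simpa using (hχlim x).mul_const (e x)
  have hweak := fun n => hu.weak_eq_mul hJ hθ hT hθT (hψc n) (hψA n)
    (r := (hχ n).2.2.choose) fun x hx => by simp [hψdef, (hχ n).2.2.choose_spec x hx]
  have hθc : Continuous θ := hθ.continuous
  have hθ'c : Continuous (deriv θ) := hθ.continuous_deriv le_rfl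
  obtain ⟨C₁, hC₁⟩ := (isCompact_Icc (a := (0 : ℝ)) (b := T + 1)).exists_bound_of_continuousOn
    hθc.continuousOn
  obtain ⟨C₂, hC₂⟩ := (isCompact_Icc (a := (0 : ℝ)) (b := T + 1)).exists_bound_of_continuousOn
    hθ'c.continuousOn
  set D := 2⁻¹ * ∫ z, 4 * B * (J z * min (‖z‖ ^ 2) 1) with hD
  have hae : ∀ᵐ p ∂((volume.restrict (Ioo 0 (T + 1))).prod (volume : Measure (Eucl N))),
      |θ p.1| ≤ C₁ ∧ |deriv θ p.1| ≤ C₂ := by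
    have : ∀ᵐ t ∂(volume.restrict (Ioo 0 (T + 1))), |θ t| ≤ C₁ ∧ |deriv θ t| ≤ C₂ :=
      (ae_restrict_iff' measurableSet_Ioo).2 (ae_of_all _ fun t ht =>
        ⟨hC₁ t (Ioo_subset_Icc_self ht), hC₂ t (Ioo_subset_Icc_self ht)⟩)
    exact Measure.quasiMeasurePreserving_fst.ae this
  have hlim1 : Tendsto (fun n => ∫ p : ℝ × Eucl N,
      u p.1 p.2 * (deriv θ p.1 * ψ n p.2 - θ p.1 * levyOp J (ψ n) p.2)
      ∂((volume.restrict (Ioo 0 (T + 1))).prod volume)) atTop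
      (𝓝 (∫ p : ℝ × Eucl N, u p.1 p.2 * (deriv θ p.1 * e p.2 - θ p.1 * levyOp J e p.2)
      ∂((volume.restrict (Ioo 0 (T + 1))).prod volume))) := by
    refine tendsto_integral_of_dominated_convergence
      (fun p => ‖u p.1 p.2‖ * (C₂ * B + C₁ * D)) (fun n => ?_) (hP.norm.mul_const _) (fun n => ?_)
      (ae_of_all _ fun p => ?_)
    · refine hP.1.mul (Measurable.aestronglyMeasurable ?_)
      have h1 := (hψA n).continuous.measurable
      have h2 := measurable_levyOp hJ (hψA n).continuous
      have h3 := hθc.measurable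
      have h4 := hθ'c.measurable
      fun_prop
    · filter_upwards [hae] with p hp
      rw [norm_mul]
      refine mul_le_mul_of_nonneg_left ((norm_sub_le _ _).trans (add_le_add ?_ ?_)) (norm_nonneg _)
      · rw [norm_mul]
        exact mul_le_mul hp.2 ((hψA n).bound _) (norm_nonneg _) ((abs_nonneg _).trans hp.2)
      · rw [norm_mul]
        exact mul_le_mul hp.1 ((hψA n).abs_levyOp_le hJ _) (norm_nonneg _)
          ((abs_nonneg _).trans hp.1)
    · exact (((hψlim _).const_mul _).sub ((tendsto_levyOp hJ hψA hψlim _).const_mul _)).const_mul _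
  have hlim2 : Tendsto (fun n => ∫ x, ψ n x * u₀ x) atTop (𝓝 (∫ x, e x * u₀ x)) := by
    refine tendsto_integral_of_dominated_convergence (fun x => B * ‖u₀ x‖) (fun n => ?_)
      (hu₀.norm.const_mul _) (fun n => ae_of_all _ fun x => ?_)
      (ae_of_all _ fun x => (hψlim x).mul_const _)
    · exact (hψA n).continuous.aestronglyMeasurable.mul hu₀.1
    · rw [norm_mul]
      exact mul_le_mul_of_nonneg_right ((hψA n).bound x) (norm_nonneg _)
  have hfin := tendsto_nhds_unique (tendsto_const_nhds.congr fun n => (hweak n).symm)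
    (hlim1.add (hlim2.const_mul (θ 0)))
  have hlev : ∀ x, levyOp J e x = multiplier J ξ * e x := levyOp_cos J ξ b
  have hrew : ∀ p : ℝ × Eucl N, u p.1 p.2 * (deriv θ p.1 * e p.2 - θ p.1 * levyOp J e p.2)
      = (deriv θ p.1 - multiplier J ξ * θ p.1) * (u p.1 p.2 * e p.2) := fun p => by
    rw [hlev]; ring
  simp_rw [hrew] at hfin
  have hint : Integrable (fun p : ℝ × Eucl N =>
      (deriv θ p.1 - multiplier J ξ * θ p.1) * (u p.1 p.2 * e p.2))
      ((volume.restrict (Ioo 0 (T + 1))).prod volume) := by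
    refine Integrable.bdd_mul (c := C₂ + |multiplier J ξ| * C₁) (hP.mul_bdd (c := 1) ?_ ?_) ?_ ?_
    · have := hee.continuous
      exact Continuous.aestronglyMeasurable (by fun_prop)
    · exact ae_of_all _ fun p => Real.abs_cos_le_one _
    · exact Continuous.aestronglyMeasurable (by fun_prop)
    · filter_upwards [hae] with p hp
      refine (norm_sub_le _ _).trans (add_le_add hp.2 ?_)
      rw [norm_mul]
      exact mul_le_mul_of_nonneg_left hp.1 (norm_nonneg _)
  rw [integral_prod _ hint] at hfin
  simp_rw [integral_const_mul, mul_comm (e _) (u₀ _)] at hfin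
  exact hfin.symm

end IsWeakSolution

/-! ### The Fourier transform on `L¹` and convolution with measures. -/

/-- The Fourier transform `∫ f(x) exp(i x · ξ) dx`, normalised as `charFun`. -/
noncomputable def fourierChar (f : Eucl N → ℝ) (ξ : Eucl N) : ℂ :=
  ∫ x, (f x : ℂ) * Complex.exp ((inner ℝ x ξ : ℝ) * Complex.I)

theorem integrable_fourierChar {f : Eucl N → ℝ} (hf : Integrable f) (ξ : Eucl N) :
    Integrable fun x => (f x : ℂ) * Complex.exp ((inner ℝ x ξ : ℝ) * Complex.I) :=
  hf.ofReal.mul_bdd (c := 1) (by fun_prop)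
    (ae_of_all _ fun x => (Complex.norm_exp_ofReal_mul_I _).le)

theorem continuous_fourierChar {f : Eucl N → ℝ} (hf : Integrable f) :
    Continuous (fourierChar f) := by
  refine continuous_of_dominated (bound := fun x => ‖f x‖)
    (fun ξ => (integrable_fourierChar hf ξ).1) (fun ξ => ae_of_all _ fun x => ?_) hf.norm
    (ae_of_all _ fun x => by fun_prop)
  rw [norm_mul, Complex.norm_exp_ofReal_mul_I, mul_one, Complex.norm_real]

/-- Two phases of the cosine, `0` and `-π/2`, recover the complex transform. -/
theorem fourierChar_eq_cos {f : Eucl N → ℝ} (hf : Integrable f) (ξ : Eucl N) :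
    fourierChar f ξ = ((∫ x, f x * Real.cos (inner ℝ x ξ + 0) : ℝ) : ℂ)
      + ((∫ x, f x * Real.cos (inner ℝ x ξ + -(Real.pi / 2)) : ℝ) : ℂ) * Complex.I := by
  have hcos : ∀ b : ℝ, Integrable fun x => f x * Real.cos (inner ℝ x ξ + b) := fun b =>
    integrable_mul_bounded hf (by fun_prop) fun x => Real.abs_cos_le_one _
  rw [← integral_complex_ofReal, ← integral_complex_ofReal, ← integral_mul_const,
    ← integral_add (hcos _).ofReal ((hcos _).ofReal.mul_const _), fourierChar]
  refine integral_congr_ae (ae_of_all _ fun x => ?_)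
  simp only [add_zero, ← sub_eq_add_neg, Real.cos_sub_pi_div_two, Complex.exp_mul_I]
  push_cast
  ring

theorem fourierChar_sub {f g : Eucl N → ℝ} (hf : Integrable f) (hg : Integrable g) (ξ : Eucl N) :
    fourierChar (fun x => f x - g x) ξ = fourierChar f ξ - fourierChar g ξ := by
  rw [fourierChar, fourierChar, fourierChar,
    ← integral_sub (integrable_fourierChar hf ξ) (integrable_fourierChar hg ξ)]
  refine integral_congr_ae (ae_of_all _ fun x => ?_)
  push_cast
  ring

/-- The Fourier transform is injective on `L¹`. -/
theorem ae_eq_zero_of_fourierChar_eq_zero {f : Eucl N → ℝ} (hf : Integrable f)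
    (h : ∀ ξ, fourierChar f ξ = 0) : f =ᵐ[volume] 0 := by
  have hp := isFiniteMeasure_densityMeasure hf
  have hn := isFiniteMeasure_densityMeasure hf.neg
  have hmp : AEMeasurable (fun x => ENNReal.ofReal (f x)) := hf.1.aemeasurable.ennreal_ofReal
  have hmn : AEMeasurable (fun x => ENNReal.ofReal ((-f) x)) :=
    hf.neg.1.aemeasurable.ennreal_ofReal
  have hsmul : ∀ {g : Eucl N → ℝ}, Integrable g → ∀ ξ : Eucl N, Integrable fun x =>
      (ENNReal.ofReal (g x)).toReal • Complex.exp ((inner ℝ x ξ : ℝ) * Complex.I) := by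
    intro g hg ξ
    have h1 : Integrable fun x => (ENNReal.ofReal (g x)).toReal := by
      simpa only [ENNReal.toReal_ofReal'] using hg.pos_part
    simp_rw [Complex.real_smul]
    exact h1.ofReal.mul_bdd (c := 1) (by fun_prop)
      (ae_of_all _ fun x => (Complex.norm_exp_ofReal_mul_I _).le)
  -- The positive and negative parts of `f` are densities of finite measures with the same
  -- characteristic function.
  have heq : densityMeasure f = densityMeasure (-f) := by
    refine Measure.ext_of_charFun (funext fun ξ => ?_)
    rw [charFun_apply, charFun_apply,
      integral_withDensity_eq_integral_toReal_smul₀ hmp (ae_of_all _ fun _ => ENNReal.ofReal_lt_top),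
      integral_withDensity_eq_integral_toReal_smul₀ hmn (ae_of_all _ fun _ => ENNReal.ofReal_lt_top),
      ← sub_eq_zero, ← integral_sub (hsmul hf ξ) (hsmul hf.neg ξ), ← h ξ, fourierChar]
    refine integral_congr_ae (ae_of_all _ fun x => ?_)
    simp only [ENNReal.toReal_ofReal', Pi.neg_apply, Complex.real_smul]
    rcases le_total 0 (f x) with h0 | h0
    · rw [max_eq_left h0, max_eq_right (neg_nonpos.2 h0)]; simp
    · rw [max_eq_right h0, max_eq_left (neg_nonneg.2 h0)]; simp
  have hae := (withDensity_eq_iff hmp hmn hf.lintegral_lt_top.ne).1 heq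
  filter_upwards [hae] with x hx
  rcases le_total 0 (f x) with h0 | h0
  · rw [Pi.neg_apply, ENNReal.ofReal_of_nonpos (neg_nonpos.2 h0), ENNReal.ofReal_eq_zero] at hx
    exact le_antisymm hx h0
  · rw [ENNReal.ofReal_of_nonpos h0, eq_comm, ENNReal.ofReal_eq_zero, Pi.neg_apply,
      neg_nonpos] at hx
    exact le_antisymm h0 hx

section Convolution

variable {f : Eucl N → ℝ} {ν : Measure (Eucl N)} [IsFiniteMeasure ν]

/-- The shear `(y, x) ↦ (y, x - y)` preserves `ν ⊗ dx` for any finite `ν`, because it translates in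
the Lebesgue variable only. -/
theorem integrable_comp_sub_prod (hf : Integrable f) :
    Integrable (fun p : Eucl N × Eucl N => f (p.1 - p.2)) (volume.prod ν) := by
  have hT : MeasurePreserving (fun p : Eucl N × Eucl N => (p.1, p.2 - p.1))
      (ν.prod volume) (ν.prod volume) :=
    (MeasurePreserving.id ν).skew_product (g := fun y x => x - y) (by fun_prop)
      (ae_of_all _ fun y => (measurePreserving_sub_right volume y).map_eq)
  have h1 : Integrable (fun p : Eucl N × Eucl N => f p.2) (ν.prod volume) :=
    hf.comp_snd ν
  exact (hT.integrable_comp_of_integrable h1).swap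

theorem integrable_convMeasure (hf : Integrable f) : Integrable (convMeasure f ν) :=
  (integrable_comp_sub_prod hf).integral_prod_left

theorem fourierChar_convMeasure (hf : Integrable f) (ξ : Eucl N) :
    fourierChar (convMeasure f ν) ξ = charFun ν ξ * fourierChar f ξ := by
  have hint : Integrable (fun p : Eucl N × Eucl N => (f (p.1 - p.2) : ℂ) *
      Complex.exp ((inner ℝ p.1 ξ : ℝ) * Complex.I)) (volume.prod ν) :=
    (integrable_comp_sub_prod hf).ofReal.mul_bdd (c := 1) (by fun_prop)
      (ae_of_all _ fun x => (Complex.norm_exp_ofReal_mul_I _).le)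
  calc fourierChar (convMeasure f ν) ξ
      = ∫ x, ∫ y, (f (x - y) : ℂ) * Complex.exp ((inner ℝ x ξ : ℝ) * Complex.I) ∂ν := by
        simp_rw [fourierChar, convMeasure, ← integral_complex_ofReal, integral_mul_const]
    _ = ∫ y, (∫ x, (f (x - y) : ℂ) * Complex.exp ((inner ℝ x ξ : ℝ) * Complex.I)) ∂ν :=
        integral_integral_swap hint
    _ = ∫ y, Complex.exp ((inner ℝ y ξ : ℝ) * Complex.I) * fourierChar f ξ ∂ν := by
        refine integral_congr_ae (ae_of_all _ fun y => ?_)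
        simp only
        rw [← integral_add_right_eq_self _ y, fourierChar, ← integral_const_mul]
        refine integral_congr_ae (ae_of_all _ fun x => ?_)
        simp only [add_sub_cancel_right, inner_add_left, Complex.ofReal_add, add_mul,
          Complex.exp_add]
        ring
    _ = charFun ν ξ * fourierChar f ξ := by rw [integral_mul_const, charFun_apply]

end Convolution

/-! ### Uniqueness of weak solutions. -/

namespace IsWeakSolution

variable {J u₀ : Eucl N → ℝ} {u : ℝ → Eucl N → ℝ}

theorem integrableOn_cos (hu : IsWeakSolution J u₀ u) {T : ℝ} (hT : 0 < T) (ξ : Eucl N) (b : ℝ) :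
    IntegrableOn (fun t => ∫ x, u t x * Real.cos (inner ℝ x ξ + b)) (Ioo 0 T) := by
  have h : Integrable (fun p : ℝ × Eucl N => u p.1 p.2 * Real.cos (inner ℝ p.2 ξ + b))
      ((volume.restrict (Ioo 0 T)).prod volume) :=
    (hu.integrable T hT).mul_bdd (c := 1) (Continuous.aestronglyMeasurable (by fun_prop))
      (ae_of_all _ fun p => Real.abs_cos_le_one _)
  exact h.integral_prod_left

theorem integrableOn_exp_mul_cos (hu : IsWeakSolution J u₀ u) {T : ℝ} (hT : 0 < T) (ξ : Eucl N)
    (b m : ℝ) :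
    IntegrableOn (fun t => Real.exp (t * m) * ∫ x, u t x * Real.cos (inner ℝ x ξ + b))
      (Ioo 0 T) := by
  refine Integrable.bdd_mul (c := Real.exp (T * |m|)) (hu.integrableOn_cos hT ξ b)
    (Continuous.aestronglyMeasurable (by fun_prop))
    ((ae_restrict_iff' measurableSet_Ioo).2 (ae_of_all _ fun t ht => ?_))
  rw [Real.norm_of_nonneg (Real.exp_pos _).le]
  refine Real.exp_le_exp.2 ?_
  calc t * m ≤ t * |m| := mul_le_mul_of_nonneg_left (le_abs_self m) ht.1.le
    _ ≤ T * |m| := mul_le_mul_of_nonneg_right ht.2.le (abs_nonneg m)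

/-- The weak form of `a' = -m a`, `a(0) = a₀`, solved by an integrating factor: `exp (t m) a(t) -
a₀` integrates to zero against every smooth function compactly supported in `(0, ∞)`. -/
theorem integral_cos_ae_eq (hu : IsWeakSolution J u₀ u) (hJ : IsEvenLevyDensity J)
    (hu₀ : Integrable u₀) (ξ : Eucl N) (b : ℝ) :
    ∀ᵐ t, 0 < t → ∫ x, u t x * Real.cos (inner ℝ x ξ + b)
      = Real.exp (-(t * multiplier J ξ)) * ∫ x, u₀ x * Real.cos (inner ℝ x ξ + b) := by
  set m := multiplier J ξ with hm
  set a : ℝ → ℝ := fun t => ∫ x, u t x * Real.cos (inner ℝ x ξ + b) with ha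
  set a₀ := ∫ x, u₀ x * Real.cos (inner ℝ x ξ + b) with ha₀
  have hint : ∀ T > 0, IntegrableOn (fun t => Real.exp (t * m) * a t) (Ioo 0 T) := fun T hT =>
    hu.integrableOn_exp_mul_cos hT ξ b m
  have hmain : ∀ᵐ t, t ∈ Ioi (0 : ℝ) → Real.exp (t * m) * a t - a₀ = 0 := by
    refine isOpen_Ioi.ae_eq_zero_of_integral_contDiff_smul_eq_zero ?_ fun g hg hgc hgs => ?_
    · rw [locallyIntegrableOn_iff isOpen_Ioi.isLocallyClosed]
      intro k hk hkc
      obtain ⟨T, hT⟩ := hkc.bddAbove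
      have hsub : k ⊆ Ioo 0 (max T 0 + 1) := fun t ht =>
        ⟨hk ht, ((hT ht).trans (le_max_left T 0)).trans_lt (lt_add_one _)⟩
      have hT0 : 0 < max T 0 + 1 := by linarith [le_max_right T 0]
      exact ((hint _ hT0).sub (integrableOn_const measure_Ioo_lt_top.ne)).mono_set hsub
    · have hgcont : Continuous g := hg.continuous
      obtain ⟨T₀, hT₀⟩ := hgc.isCompact.bddAbove
      set T := max T₀ 0 + 1 with hTdef
      have hT : 0 < T := by linarith [le_max_right T₀ 0]
      have hgT : ∀ t, T ≤ t → g t = 0 := fun t ht => image_eq_zero_of_notMem_tsupport fun h => by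
        linarith [hT₀ h, le_max_left T₀ 0]
      have hg0 : ∀ t, t ≤ 0 → g t = 0 := fun t ht => image_eq_zero_of_notMem_tsupport fun h =>
        not_lt.2 ht (hgs h)
      -- `η` is the primitive of `-g` that vanishes for `t ≥ T`. With `θ = exp (t m) η` one has `θ'
      -- - m θ = -exp (t m) g` and `θ(0) = ∫ g`, so the weak equation becomes `∫ g exp (t m) a = a₀
      -- ∫ g`.
      set η : ℝ → ℝ := fun t => (∫ s in (0 : ℝ)..T, g s) - ∫ s in (0 : ℝ)..t, g s with hη
      have hηd : ∀ t, HasDerivAt η (-g t) t := fun t =>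
        (intervalIntegral.integral_hasDerivAt_right (hgcont.intervalIntegrable _ _)
          (hgcont.stronglyMeasurableAtFilter _ _) hgcont.continuousAt).const_sub _
      have hθd : ∀ t, HasDerivAt (fun t => Real.exp (t * m) * η t)
          (m * (Real.exp (t * m) * η t) - Real.exp (t * m) * g t) t := fun t => by
        have h1 : HasDerivAt (fun t => Real.exp (t * m)) (Real.exp (t * m) * m) t := by
          simpa using ((hasDerivAt_id t).mul_const m).exp
        convert! h1.mul (hηd t) using 1
        ring
      have hηcont : Continuous η :=
        continuous_iff_continuousAt.2 fun t => (hηd t).continuousAt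
      have hθ : ContDiff ℝ 1 (fun t => Real.exp (t * m) * η t) := by
        refine contDiff_one_iff_deriv.2 ⟨fun t => (hθd t).differentiableAt, ?_⟩
        rw [funext fun t => (hθd t).deriv]
        fun_prop
      have hηT : ∀ t, T ≤ t → Real.exp (t * m) * η t = 0 := fun t ht => by
        have : ∫ s in T..t, g s = 0 := by
          rw [intervalIntegral.integral_congr (g := fun _ => (0 : ℝ)) fun s hs => ?_]
          · simp
          · rw [uIcc_of_le ht] at hs
            exact hgT s hs.1
        simp only [hη]
        rw [← intervalIntegral.integral_add_adjacent_intervals (hgcont.intervalIntegrable 0 T)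
          (hgcont.intervalIntegrable T t), this]
        simp
      have hw := hu.weak_eq_cos hJ hu₀ hθ hT hηT ξ b
      have hη0 : η 0 = ∫ s in Ioo 0 (T + 1), g s := by
        simp only [hη, intervalIntegral.integral_same, sub_zero]
        rw [intervalIntegral.integral_of_le hT.le]
        refine (setIntegral_eq_of_subset_of_forall_sdiff_eq_zero measurableSet_Ioo
          (fun t ht => ⟨ht.1, by linarith [ht.2]⟩) fun t ht => hgT t ?_).symm
        by_contra hlt
        exact ht.2 ⟨ht.1.1, (not_le.1 hlt).le⟩
      have hT1 : 0 < T + 1 := by linarith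
      obtain ⟨C, hC⟩ := hgcont.bounded_above_of_compact_support hgc
      have hi1 : IntegrableOn (fun t => g t * (Real.exp (t * m) * a t)) (Ioo 0 (T + 1)) :=
        Integrable.bdd_mul (c := C) (hint _ hT1) hgcont.aestronglyMeasurable (ae_of_all _ hC)
      have hi2 : IntegrableOn (fun t => g t * a₀) (Ioo 0 (T + 1)) :=
        (hgcont.integrable_of_hasCompactSupport hgc).integrableOn.mul_const _
      have hrestr : ∫ t, g t • (Real.exp (t * m) * a t - a₀)
          = ∫ t in Ioo 0 (T + 1), g t • (Real.exp (t * m) * a t - a₀) := by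
        refine (setIntegral_eq_integral_of_forall_compl_eq_zero fun t ht => ?_).symm
        have : g t = 0 := by
          by_cases h0 : t ≤ 0
          · exact hg0 t h0
          · refine hgT t ?_
            by_contra hlt
            exact ht ⟨not_le.1 h0, by linarith⟩
        rw [this, zero_smul]
      rw [hrestr]
      simp only [smul_eq_mul, mul_sub]
      rw [integral_sub hi1 hi2, integral_mul_const, ← hη0]
      have hw' : ∫ t in Ioo 0 (T + 1), (deriv (fun t => Real.exp (t * m) * η t) t
          - m * (Real.exp (t * m) * η t)) * a t
          = -∫ t in Ioo 0 (T + 1), g t * (Real.exp (t * m) * a t) := by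
        rw [← integral_neg]
        refine integral_congr_ae (ae_of_all _ fun t => ?_)
        simp only [(hθd t).deriv]
        ring
      rw [hw'] at hw
      simp only [zero_mul, Real.exp_zero, one_mul] at hw
      linarith
  filter_upwards [hmain] with t ht h0
  have h1 := ht h0
  rw [Real.exp_neg, ← sub_eq_zero.1 h1, inv_mul_cancel_left₀ (Real.exp_pos _).ne']

/-- Uniqueness: a weak solution is given by the fundamental solution. -/
theorem ae_eq_convMeasure (hu : IsWeakSolution J u₀ u) (hJ : IsEvenLevyDensity J)
    (hu₀ : Integrable u₀) {μ : ℝ → Measure (Eucl N)} (hμ : IsFundamentalSolution J μ) :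
    ∀ᵐ t, 0 < t → u t =ᵐ[volume] convMeasure u₀ (μ t) := by
  have hint : ∀ᵐ t, 0 < t → Integrable (u t) := by
    have h : ∀ᵐ t, ∀ n : ℕ, t ∈ Ioo (0 : ℝ) (n + 1) → Integrable (u t) :=
      ae_all_iff.2 fun n =>
        (ae_restrict_iff' measurableSet_Ioo).1 (hu.ae_integrable (by positivity))
    filter_upwards [h] with t ht h0
    obtain ⟨n, hn⟩ := exists_nat_gt t
    exact ht n ⟨h0, by linarith⟩
  -- The exceptional times depend on `ξ` and `b`; countably many frequencies and two phases leave a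
  -- single null set, and continuity of the transforms recovers every `ξ`.
  have hdense : ∀ᵐ t, ∀ n : ℕ, ∀ b ∈ ({0, -(Real.pi / 2)} : Set ℝ), 0 < t →
      ∫ x, u t x * Real.cos (inner ℝ x (TopologicalSpace.denseSeq (Eucl N) n) + b)
      = Real.exp (-(t * multiplier J (TopologicalSpace.denseSeq (Eucl N) n)))
        * ∫ x, u₀ x * Real.cos (inner ℝ x (TopologicalSpace.denseSeq (Eucl N) n) + b) :=
    ae_all_iff.2 fun n => (ae_ball_iff (Set.toFinite _).countable).2 fun b _ =>
      hu.integral_cos_ae_eq hJ hu₀ _ b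
  filter_upwards [hint, hdense] with t ht1 ht2 h0
  have hut := ht1 h0
  have := (hμ t h0).1
  have hconv := integrable_convMeasure (ν := μ t) hu₀
  have hF : fourierChar (u t) = fourierChar (convMeasure u₀ (μ t)) := by
    refine (continuous_fourierChar hut).ext_on (TopologicalSpace.denseRange_denseSeq _)
      (continuous_fourierChar hconv) ?_
    rintro _ ⟨n, rfl⟩
    rw [fourierChar_convMeasure hu₀, (hμ t h0).2, fourierChar_eq_cos hut, fourierChar_eq_cos hu₀,
      ht2 n 0 (by simp) h0, ht2 n _ (by simp) h0]
    push_cast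
    ring
  have h := ae_eq_zero_of_fourierChar_eq_zero (hut.sub hconv) fun ξ =>
    (fourierChar_sub hut hconv ξ).trans (by rw [hF, sub_self])
  filter_upwards [h] with x hx using sub_eq_zero.1 hx

end IsWeakSolution

end NonlocalHeat

theorem mainTheorem5 {N : ℕ} (hN : 1 ≤ N) (J : NonlocalHeat.Eucl N → ℝ)
    (hJ : NonlocalHeat.IsLevyKernel J)
    (α : ℝ) (hα₀ : 0 < α) (hα₂ : α ≤ 2)
    (htail : ∃ c > 0, ∃ R : ℝ, ∀ z, R ≤ ‖z‖ → c * ‖z‖ ^ (-((N : ℝ) + α)) ≤ J z)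
    (u₀ : NonlocalHeat.Eucl N → ℝ) (hu₁ : MemLp u₀ 1 volume) (hu_top : MemLp u₀ ∞ volume) :
    (∃ μ : ℝ → Measure (NonlocalHeat.Eucl N), NonlocalHeat.IsFundamentalSolution J μ ∧
      Tendsto (fun t => eLpNorm (NonlocalHeat.convMeasure u₀ (μ t)) ∞ volume) atTop (𝓝 0)) ∧
    ∀ u : ℝ → NonlocalHeat.Eucl N → ℝ, NonlocalHeat.IsWeakSolution J u₀ u →
      Tendsto (fun t => eLpNorm (u t) ∞ volume) (atTop ⊓ ae (volume : Measure ℝ)) (𝓝 0) := by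
  have hJ' := hJ.isEvenLevyDensity
  obtain ⟨μ, hμ⟩ := hJ'.exists_isFundamentalSolution
  have hlim := NonlocalHeat.tendsto_eLpNorm_convMeasure hN hJ' hα₀ htail hμ hu₁ hu_top
  refine ⟨⟨μ, hμ, hlim⟩, fun u hu => (hlim.mono_left inf_le_left).congr' ?_⟩
  filter_upwards [mem_inf_of_left (eventually_gt_atTop 0),
    mem_inf_of_right (hu.ae_eq_convMeasure hJ' (memLp_one_iff_integrable.1 hu₁) hμ)] with t h0 ht
  exact (eLpNorm_congr_ae (ht h0)).symm
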